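/- Let $\mu$ be a probability measure on $\mathbb{R}_+=[0,\infty)$ with Laplace exponent $\psi_\mu(u)=-\log\int_{[0,\infty)}e^{-ux}\,\mu(dx)$, $u\ge 0$. Call $f:[0,\infty)\to\mathbb{R}$ a Bernstein function (vanishing at zero) if $f(u)=au+\int_{(0,\infty)}(1-e^{-ut})\,\nu(dt)$ for all $u\ge 0$, for some $a\ge 0$ and some measure $\nu$ on $(0,\infty)$ with $\int_{(0,\infty)}\min(1,t)\,\nu(dt)<\infty$. A subordinator is a real-valued Lévy process (started at $0$, with independent stationary increments and a.s. càdlàg paths) with a.s. nondecreasing paths. Then the following statements are equivalent. (i) $\mu$ is selfdecomposable: for every $c\in(0,1)$ there is a real random variable $Y_c$ such that $\mu$ is the law of $cX'+Y_c$, where $X'$ has law $\mu$ and is independent of $Y_c$. (ii) $u\mapsto\psi_\mu(u)-\psi_\mu(cu)$ is a Bernstein function for all $c\in(0,1)$. (iii) $u\mapsto\psi_\mu(cu)-\psi_\mu(u)$ is a Bernstein function for all $c>1$. (iv) $u\mapsto u\,\psi_\mu'(u)$, $u>0$, extended by the value $0$ at $u=0$, is a Bernstein function. (v) $\mu$ is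 the law of the pathwise Lebesgue–Stieltjes integral $\int_{(0,\infty)}e^{-t}\,dX_t$ for some subordinator $(X_t)_{t\ge 0}$ with $\mathbb{E}[\log^+(X_1)]<\infty$. -/

import Mathlib

open MeasureTheory ProbabilityTheory Set Filter Topology
open scoped NNReal ENNReal Real

noncomputable section

/-- The Laplace exponent `ψ_μ(u) = -log ∫ e^{-ux} μ(dx)`, so that `∫ e^{-ux} μ(dx) = e^{-ψ_μ(u)}`
for `u ≥ 0`, of a probability measure `μ` on `[0, ∞)`, regarded as a measure on `ℝ`. -/
def laplaceExponent (μ : Measure ℝ) (u : ℝ) : ℝ :=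
  -Real.log (∫ x, Real.exp (-(u * x)) ∂μ)

/-- Bernstein functions vanishing at zero: `f(u) = a u + ∫_{(0,∞)} (1 - e^{-ut}) ν(dt)` for `u ≥ 0`,
with a drift `a ≥ 0` and a Lévy measure `ν` on `(0, ∞)`, that is, `∫_{(0,∞)} min(1, t) ν(dt) < ∞`.
Only the values of `f` on `[0, ∞)` matter. -/
def IsBernstein (f : ℝ → ℝ) : Prop :=
  ∃ (a : ℝ) (ν : Measure ℝ), 0 ≤ a ∧ ν (Iic 0) = 0 ∧
    ∫⁻ t, ENNReal.ofReal (min 1 t) ∂ν < ∞ ∧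
    ∀ u : ℝ, 0 ≤ u → f u = a * u + ∫ t, (1 - Real.exp (-(u * t))) ∂ν

/-- `μ` is selfdecomposable: for every `c ∈ (0, 1)` it is the law of `c X' + Y_c`, where `X'` has
law `μ` and `Y_c` is some real random variable (with law `ρ`) independent of `X'`. -/
def IsSelfdecomposable (μ : Measure ℝ) : Prop :=
  ∀ c : ℝ, 0 < c → c < 1 →
    ∃ ρ : Measure ℝ, IsProbabilityMeasure ρ ∧
      μ = (μ.prod ρ).map (fun p : ℝ × ℝ => c * p.1 + p.2)

/-- Real-valued Lévy processes: start at zero, independent and stationary increments,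
almost surely càdlàg paths. -/
structure IsLevyProcess {Ω : Type*} [MeasurableSpace Ω] (X : ℝ≥0 → Ω → ℝ) (P : Measure Ω) :
    Prop where
  measurable : ∀ t, Measurable (X t)
  start_zero : ∀ᵐ ω ∂P, X 0 ω = 0
  indep_increments : HasIndepIncrements X P
  stationary_increments : ∀ s h : ℝ≥0,
    IdentDistrib (fun ω => X (s + h) ω - X s ω) (fun ω => X h ω - X 0 ω) P P
  right_continuous : ∀ᵐ ω ∂P, ∀ t : ℝ≥0, ContinuousWithinAt (fun s => X s ω) (Ici t) t
  left_limits : ∀ᵐ ω ∂P, ∀ t : ℝ≥0, ∃ l : ℝ, Tendsto (fun s => X s ω) (𝓝[<] t) (𝓝 l)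

/-- A subordinator is a Lévy process with (almost surely) nondecreasing paths. -/
structure IsSubordinator {Ω : Type*} [MeasurableSpace Ω] (X : ℝ≥0 → Ω → ℝ) (P : Measure Ω) :
    Prop extends IsLevyProcess X P where
  nondecreasing : ∀ᵐ ω ∂P, Monotone (fun t => X t ω)

open Classical in
/-- The Lebesgue–Stieltjes measure `df` of a nondecreasing right-continuous `f : [0, ∞) → ℝ`,
characterized by `df((a, b]) = f b - f a`. It has no mass at `0`, so integrating
against it over `[0, ∞)` is the same as integrating over `(0, ∞)`. The value is `0` for all
other `f`. -/
def pathMeasure (f : ℝ≥0 → ℝ) : Measure ℝ≥0 :=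
  if h : Monotone f ∧ ∀ t, ContinuousWithinAt f (Ici t) t then
    StieltjesFunction.measure ⟨f, h.1, h.2⟩
  else 0

/-- The pathwise Lebesgue–Stieltjes integral `∫_{(0,∞)} e^{-t} dX_t`, with values in `[0, ∞]`. -/
def expIntegral {Ω : Type*} (X : ℝ≥0 → Ω → ℝ) (ω : Ω) : ℝ≥0∞ :=
  ∫⁻ t in Ioi (0 : ℝ≥0), ENNReal.ofReal (Real.exp (-(t : ℝ))) ∂(pathMeasure fun s => X s ω)

end

/-!
The theorem identifies the five properties through the function `f(u) = u ψ'(u)`, where `ψ` is the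
Laplace exponent of `μ`. By the chain rule, `s ↦ -ψ(u e^{-s})` is a primitive of
`s ↦ f(u e^{-s})`, whence
`ψ(u) - ψ(cu) = ∫_0^{log (1/c)} f(u e^{-s}) ds` and `ψ(u) = ∫_0^∞ f(u e^{-s}) ds`.

* If `f` is a Bernstein function, the first identity exhibits `ψ(u) - ψ(cu)` as a mixture of
  Bernstein functions (`isBernstein_sub_of_isBernstein_mul_deriv`). The statement for `c > 1` is the
  one for `1/c` after rescaling `u`.
* If `ψ(u) - ψ(cu)` is a Bernstein function, it is the Laplace exponent of `X_1` for a subordinator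
  `X`, and the law of `X_1` is the cofactor of `c X'` in the decomposition of `μ`
  (`isSelfdecomposable_of_isBernstein_sub`).
* If `μ` is selfdecomposable with cofactors `Y_c`, then `Y_c ≥ 0`, and `f(u)` is the limit of
  `(1 - E e^{-u Y_c}) / (1 - c)` as `c → 1`, hence a limit of Bernstein functions. Such a limit is a
  Bernstein function as soon as it vanishes continuously at `0` (`isBernstein_of_tendsto`).
* If `f` is the Bernstein function of `(a, ν)`, the subordinator `X` with this drift and Lévy
  measure is constructed from a Poisson random measure. The Laplace functional of `dX` and the second
  identity show that `∫ e^{-t} dX_t` has Laplace exponent `ψ`; finiteness of `ψ(1)` also yields the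
  logarithmic moment of `X_1` (`exists_subordinator_of_isBernstein_mul_deriv`).
* If `μ` is the law of `∫ e^{-t} dX_t`, splitting the integral at `t = log (1/c)` gives the
  decomposition (`isSelfdecomposable_of_hasLaw_expIntegral`). This is carried out on Laplace
  transforms of Riemann sums.

Laws on `[0, ∞]` are compared through their Laplace transforms, written as `ℝ≥0∞`-valued integrals
of `expNeg x = e^{-x}` with `e^{-∞} = 0`, so that neither finiteness nor integrability has to be known
beforehand; `ext_of_lintegral_expNeg_eq` shows that they determine the law.
-/

/-! ### The function `e^{-x}` on `[0, ∞]` -/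

/-- The function `x ↦ e^{-x}` on `[0, ∞]`, with `e^{-∞} = 0`. -/
noncomputable def expNeg (x : ℝ≥0∞) : ℝ≥0∞ := EReal.exp (-(x : EReal))

@[simp] lemma expNeg_zero : expNeg 0 = 1 := by simp [expNeg]

@[simp] lemma expNeg_top : expNeg ∞ = 0 := by simp [expNeg]

lemma expNeg_strictAnti : StrictAnti expNeg := fun x y h => by
  simp only [expNeg, EReal.exp_lt_exp_iff]
  exact EReal.neg_lt_neg_iff.2 (by exact_mod_cast h)

lemma expNeg_antitone : Antitone expNeg := expNeg_strictAnti.antitone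

lemma expNeg_le_one (x : ℝ≥0∞) : expNeg x ≤ 1 := expNeg_zero ▸ expNeg_antitone zero_le

lemma expNeg_ne_top (x : ℝ≥0∞) : expNeg x ≠ ∞ := ne_top_of_le_ne_top (by simp) (expNeg_le_one x)

lemma expNeg_add (x y : ℝ≥0∞) : expNeg (x + y) = expNeg x * expNeg y := by
  simp only [expNeg]
  rw [EReal.coe_ennreal_add, EReal.neg_add, sub_eq_add_neg, EReal.exp_add]
  · left; exact EReal.coe_ennreal_ne_bot x
  · right; exact EReal.coe_ennreal_ne_bot y

lemma expNeg_ofReal {x : ℝ} (hx : 0 ≤ x) : expNeg (.ofReal x) = .ofReal (Real.exp (-x)) := by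
  rw [expNeg, EReal.coe_ennreal_ofReal, max_eq_left hx, ← EReal.coe_neg, EReal.exp_coe]

lemma continuous_expNeg : Continuous expNeg :=
  ENNReal.continuous_exp.comp (continuous_neg.comp continuous_coe_ennreal_ereal)

@[fun_prop] lemma measurable_expNeg : Measurable expNeg := continuous_expNeg.measurable

lemma expNeg_sum {ι : Type*} (s : Finset ι) (f : ι → ℝ≥0∞) :
    expNeg (∑ i ∈ s, f i) = ∏ i ∈ s, expNeg (f i) := by
  induction s using Finset.cons_induction with
  | empty => simp
  | cons a s ha ih => rw [Finset.sum_cons, Finset.prod_cons, expNeg_add, ih]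

lemma tendsto_prod_expNeg (f : ℕ → ℝ≥0∞) :
    Tendsto (fun n => ∏ i ∈ Finset.range n, expNeg (f i)) atTop (𝓝 (expNeg (∑' i, f i))) := by
  simp_rw [← expNeg_sum]
  exact (continuous_expNeg.tendsto _).comp (ENNReal.tendsto_nat_tsum f)

/-! ### Uniqueness of Laplace transforms -/

open BoundedContinuousFunction in
/-- A finite measure on `[0, ∞]^ι` is determined by its Laplace transform at integer points. -/
theorem ext_of_lintegral_expNeg_eq {ι : Type*} [Fintype ι] {P Q : Measure (ι → ℝ≥0∞)}
    [IsFiniteMeasure P] [IsFiniteMeasure Q]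
    (h : ∀ u : ι → ℕ, ∫⁻ x, expNeg (∑ i, u i * x i) ∂P = ∫⁻ x, expNeg (∑ i, u i * x i) ∂Q) :
    P = Q := by
  have hc (u : ι → ℕ) : Continuous fun x : ι → ℝ≥0∞ => expNeg (∑ i, u i * x i) :=
    continuous_expNeg.comp (continuous_finsetSum _ fun i _ =>
      (ENNReal.continuous_const_mul (ENNReal.natCast_ne_top _)).comp (continuous_apply i))
  -- the exponentials are closed under multiplication, so they span the algebra they generate
  let M : Submonoid ((ι → ℝ≥0∞) →ᵇ ℝ) :=
    { carrier := {g | ∃ u : ι → ℕ, ∀ x, g x = (expNeg (∑ i, u i * x i)).toReal}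
      one_mem' := ⟨0, fun x => by simp⟩
      mul_mem' := by
        rintro f g ⟨u, hu⟩ ⟨v, hv⟩
        refine ⟨u + v, fun x => ?_⟩
        simp only [BoundedContinuousFunction.coe_mul, Pi.mul_apply, hu, hv, Pi.add_apply,
          Nat.cast_add, add_mul, Finset.sum_add_distrib, expNeg_add, ENNReal.toReal_mul] }
  let A : StarSubalgebra ℝ ((ι → ℝ≥0∞) →ᵇ ℝ) :=
    { Algebra.adjoin ℝ (M : Set ((ι → ℝ≥0∞) →ᵇ ℝ)) with
      star_mem' := fun {a} ha => by
        have : star a = a := by ext x; simp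
        rwa [this] }
  refine ext_of_forall_mem_subalgebra_integral_eq_of_polish (𝕜 := ℝ) (A := A) ?_ ?_
  · intro x y hxy
    obtain ⟨i, hi⟩ := Function.ne_iff.1 hxy
    classical
    let g : (ι → ℝ≥0∞) →ᵇ ℝ := BoundedContinuousFunction.mkOfCompact
      ⟨fun x => (expNeg (∑ j, ((Pi.single i 1 : ι → ℕ) j : ℝ≥0∞) * x j)).toReal,
        continuous_iff_continuousAt.2 fun x =>
        (ENNReal.tendsto_toReal (expNeg_ne_top _)).comp (hc _).continuousAt⟩
    refine ⟨g, ⟨g.toContinuousMap, ⟨g, Algebra.subset_adjoin ⟨Pi.single i 1, fun x => rfl⟩, rfl⟩,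
      rfl⟩, ?_⟩
    have key (x : ι → ℝ≥0∞) : g x = (expNeg (x i)).toReal := by
      simp [g, Pi.single_apply]
    change g x ≠ g y
    rw [key, key]
    intro hh
    exact hi (expNeg_strictAnti.injective
      ((ENNReal.toReal_eq_toReal_iff' (expNeg_ne_top _) (expNeg_ne_top _)).1 hh))
  · intro g hg
    have hg' : g ∈ Submodule.span ℝ (M : Set ((ι → ℝ≥0∞) →ᵇ ℝ)) := by
      have : g ∈ Subalgebra.toSubmodule (Algebra.adjoin ℝ (M : Set ((ι → ℝ≥0∞) →ᵇ ℝ))) := hg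
      rwa [Algebra.adjoin_eq_span, Submonoid.closure_eq] at this
    induction hg' using Submodule.span_induction with
    | mem f hf =>
      obtain ⟨u, hu⟩ := hf
      simp_rw [hu]
      rw [integral_toReal (hc u).measurable.aemeasurable
          (ae_of_all _ fun x => (expNeg_ne_top _).lt_top),
        integral_toReal (hc u).measurable.aemeasurable
          (ae_of_all _ fun x => (expNeg_ne_top _).lt_top), h]
    | zero => simp
    | add f f' hf hf' h1 h2 =>
      have hA {f} (hf : f ∈ Submodule.span ℝ (M : Set ((ι → ℝ≥0∞) →ᵇ ℝ))) : f ∈ A := by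
        rw [← Submonoid.closure_eq M, ← Algebra.adjoin_eq_span] at hf
        exact hf
      simp only [BoundedContinuousFunction.coe_add, Pi.add_apply]
      rw [integral_add (f.integrable _) (f'.integrable _),
        integral_add (f.integrable _) (f'.integrable _), h1 (hA hf), h2 (hA hf')]
    | smul a f hf h1 =>
      have hA : f ∈ A := by
        rw [← Submonoid.closure_eq M, ← Algebra.adjoin_eq_span] at hf
        exact hf
      simp only [BoundedContinuousFunction.coe_smul]
      rw [integral_smul, integral_smul, h1 hA]

/-- A finite measure on `[0, ∞]` is determined by its Laplace transform at integer points. -/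
theorem ext_of_lintegral_expNeg_eq_one_dim {P Q : Measure ℝ≥0∞}
    [IsFiniteMeasure P] [IsFiniteMeasure Q]
    (h : ∀ u : ℕ, ∫⁻ x, expNeg (u * x) ∂P = ∫⁻ x, expNeg (u * x) ∂Q) : P = Q := by
  let e := MeasurableEquiv.funUnique Unit ℝ≥0∞
  have : P.map e.symm = Q.map e.symm := by
    refine ext_of_lintegral_expNeg_eq fun u => ?_
    rw [lintegral_map_equiv, lintegral_map_equiv]
    simpa [e] using h (u ())
  simpa [Measure.map_map] using congrArg (Measure.map e) this

/-- Random variables with values in `[0, ∞]` are independent if their joint Laplace transform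
is the product of the marginal ones. -/
theorem iIndepFun_of_lintegral_expNeg {ι Ω : Type*} [Fintype ι] [MeasurableSpace Ω]
    {P : Measure Ω} [IsProbabilityMeasure P] {X : ι → Ω → ℝ≥0∞} (hX : ∀ i, Measurable (X i))
    (h : ∀ u : ι → ℕ, ∫⁻ ω, expNeg (∑ i, u i * X i ω) ∂P =
      ∏ i, ∫⁻ ω, expNeg (u i * X i ω) ∂P) : iIndepFun X P := by
  have : ∀ i, IsProbabilityMeasure (P.map (X i)) := fun i =>
    Measure.isProbabilityMeasure_map (hX i).aemeasurable
  rw [iIndepFun_iff_map_fun_eq_pi_map fun i => (hX i).aemeasurable]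
  have : IsProbabilityMeasure (P.map fun ω i => X i ω) :=
    Measure.isProbabilityMeasure_map (measurable_pi_lambda _ hX).aemeasurable
  refine ext_of_lintegral_expNeg_eq fun u => ?_
  rw [lintegral_map (by fun_prop) (measurable_pi_lambda _ hX), h]
  simp_rw [expNeg_sum]
  rw [lintegral_prod_eq_prod_lintegral_of_indepFun Finset.univ
    (fun i (x : ι → ℝ≥0∞) => expNeg (u i * x i))
    (iIndepFun_pi (X := fun i x => expNeg (u i * x)) fun i => by fun_prop) fun i => by fun_prop]
  refine Finset.prod_congr rfl fun i _ => ?_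
  classical
  have he : (Measure.pi fun i => P.map (X i)).map (fun x => x i) = P.map (X i) := by
    have := Measure.pi_map_eval (fun i => P.map (X i)) i
    simpa using this
  rw [← lintegral_map (f := fun x => expNeg (u i * x)) (by fun_prop) (hX i), ← he,
    lintegral_map (by fun_prop) (by fun_prop)]

/-! ### Poisson random measures -/

lemma lintegral_pow_poissonMeasure (r : ℝ≥0) {a : ℝ≥0∞} (ha : a ≤ 1) :
    ∫⁻ n, a ^ n ∂(poissonMeasure r) = expNeg (r * (1 - a)) := by
  lift a to ℝ≥0 using ne_top_of_le_ne_top (by simp) ha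
  have ha' : (a : ℝ) ≤ 1 := by exact_mod_cast ha
  have h1 : (r : ℝ≥0∞) * (1 - a) = .ofReal ((r : ℝ) * (1 - (a : ℝ))) := by
    rw [ENNReal.ofReal_mul r.coe_nonneg, ENNReal.ofReal_sub _ a.coe_nonneg]
    simp
  rw [h1, expNeg_ofReal (mul_nonneg r.coe_nonneg (by linarith)), poissonMeasure,
    lintegral_sum_measure]
  simp only [lintegral_smul_measure, lintegral_dirac, smul_eq_mul]
  have h2 : HasSum (fun n : ℕ => Real.exp (-r) * r ^ n / n.factorial * a ^ n)
      (Real.exp (-(r * (1 - a)))) := by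
    have := (NormedSpace.expSeries_div_hasSum_exp ((r : ℝ) * a)).mul_left (Real.exp (-r))
    rw [← Real.exp_eq_exp_ℝ, ← Real.exp_add] at this
    convert! this using 1
    · ext n; rw [mul_pow]; ring
    · congr 1; ring
  rw [← h2.tsum_eq, ENNReal.ofReal_tsum_of_nonneg (fun n => by positivity) h2.summable]
  refine tsum_congr fun n => ?_
  rw [ENNReal.ofReal_mul (by positivity), ENNReal.ofReal_pow a.coe_nonneg,
    ENNReal.ofReal_coe_nnreal]

/-- The Laplace transform of a compound Poisson sum `∑_{i < n} g(x_i)`, with `n` Poisson of rate `r`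
and `x` an independent i.i.d. sequence. -/
lemma lintegral_expNeg_compoundPoisson {E : Type*} [MeasurableSpace E] (r : ℝ≥0) (p : Measure E)
    [IsProbabilityMeasure p] {g : E → ℝ≥0∞} (hg : Measurable g) :
    ∫⁻ y : ℕ × (ℕ → E), expNeg (∑ i ∈ Finset.range y.1, g (y.2 i))
      ∂((poissonMeasure r).prod (Measure.infinitePi fun _ => p)) =
      expNeg (r * ∫⁻ x, (1 - expNeg (g x)) ∂p) := by
  have hm : Measurable fun y : ℕ × (ℕ → E) => ∑ i ∈ Finset.range y.1, g (y.2 i) :=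
    measurable_from_prod_countable_right fun n => by
      dsimp only
      exact Finset.measurable_fun_sum _ fun i _ => by fun_prop
  have hm' : Measurable fun y : ℕ × (ℕ → E) => expNeg (∑ i ∈ Finset.range y.1, g (y.2 i)) :=
    measurable_expNeg.comp hm
  rw [lintegral_prod _ hm'.aemeasurable]
  simp_rw [expNeg_sum]
  have h1 (n : ℕ) : ∫⁻ x : ℕ → E, ∏ i ∈ Finset.range n, expNeg (g (x i))
      ∂(Measure.infinitePi fun _ => p) = (∫⁻ x, expNeg (g x) ∂p) ^ n := by
    rw [lintegral_prod_eq_prod_lintegral_of_indepFun _ (fun i (x : ℕ → E) => expNeg (g (x i)))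
      (iIndepFun_infinitePi (X := fun _ x => expNeg (g x)) fun i => by fun_prop)
      fun i => by fun_prop]
    have h2 (i : ℕ) : ∫⁻ x : ℕ → E, expNeg (g (x i)) ∂(Measure.infinitePi fun _ => p) =
        ∫⁻ x, expNeg (g x) ∂p := by
      conv_rhs => rw [← Measure.infinitePi_map_eval (fun _ : ℕ => p) i]
      rw [lintegral_map (by fun_prop) (by fun_prop)]
    simp [h2]
  simp_rw [h1]
  have h3 : ∫⁻ x, expNeg (g x) ∂p ≤ 1 := by
    calc _ ≤ ∫⁻ x, 1 ∂p := lintegral_mono fun x => expNeg_le_one _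
      _ = 1 := by simp
  rw [lintegral_pow_poissonMeasure r h3, lintegral_sub (by fun_prop)
    (ne_top_of_le_ne_top (by simp) h3) (ae_of_all _ fun x => expNeg_le_one _)]
  simp

/-- A finite measure, possibly zero, is a multiple of a probability measure. -/
lemma exists_nnreal_smul_eq {E : Type*} [MeasurableSpace E] [Nonempty E] (m : Measure E)
    [IsFiniteMeasure m] : ∃ (r : ℝ≥0) (p : Measure E), IsProbabilityMeasure p ∧ m = r • p := by
  by_cases hm : m = 0
  · exact ⟨0, .dirac (Classical.arbitrary E), inferInstance, by simp [hm]⟩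
  · have : NeZero m := ⟨hm⟩
    refine ⟨(m univ).toNNReal, (m univ)⁻¹ • m, inferInstance, ?_⟩
    ext s hs
    simp only [Measure.smul_apply, ENNReal.smul_def, ENNReal.coe_toNNReal (measure_ne_top m univ),
      smul_eq_mul]
    rw [← mul_assoc, ENNReal.mul_inv_cancel (by simpa using hm) (measure_ne_top m univ), one_mul]

/-- Existence of a Poisson random measure `N` with s-finite intensity `m`, characterized by its
Laplace functional `E exp(-∫ g dN) = exp(-∫ (1 - e^{-g}) dm)`. It is the superposition of
independent Poisson samples, one for each finite piece of `m`. -/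
theorem exists_poissonRandomMeasure {E : Type} [MeasurableSpace E] [Nonempty E] (m : Measure E)
    [SFinite m] :
    ∃ (Ω : Type) (_ : MeasurableSpace Ω) (P : Measure Ω) (N : Ω → Measure E),
      IsProbabilityMeasure P ∧
      (∀ g : E → ℝ≥0∞, Measurable g → Measurable fun ω => ∫⁻ x, g x ∂(N ω)) ∧
      ∀ g : E → ℝ≥0∞, Measurable g →
        ∫⁻ ω, expNeg (∫⁻ x, g x ∂(N ω)) ∂P = expNeg (∫⁻ x, (1 - expNeg (g x)) ∂m) := by
  choose r p hp hrp using fun n => exists_nnreal_smul_eq (sfiniteSeq m n)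
  have hint (y : ℕ → ℕ × (ℕ → E)) {g : E → ℝ≥0∞} (hg : Measurable g) :
      ∫⁻ x, g x ∂(Measure.sum fun k => Measure.sum fun i : Finset.range (y k).1 =>
        Measure.dirac ((y k).2 i)) = ∑' k, ∑ i ∈ Finset.range (y k).1, g ((y k).2 i) := by
    rw [lintegral_sum_measure]
    refine tsum_congr fun k => ?_
    rw [lintegral_sum_measure]
    simp only [lintegral_dirac' _ hg]
    rw [Finset.tsum_subtype (Finset.range (y k).1) fun i => g ((y k).2 i)]
  have hm {g : E → ℝ≥0∞} (hg : Measurable g) :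
      Measurable fun y : ℕ × (ℕ → E) => ∑ i ∈ Finset.range y.1, g (y.2 i) :=
    measurable_from_prod_countable_right fun n => by
      dsimp only
      exact Finset.measurable_fun_sum _ fun i _ => by fun_prop
  refine ⟨ℕ → ℕ × (ℕ → E), inferInstance, Measure.infinitePi fun k =>
    (poissonMeasure (r k)).prod (Measure.infinitePi fun _ => p k),
    fun y => Measure.sum fun k => Measure.sum fun i : Finset.range (y k).1 =>
        Measure.dirac ((y k).2 i), inferInstance, fun g hg => ?_, fun g hg => ?_⟩
  · simp_rw [hint _ hg]
    exact Measurable.tsum fun k => (hm hg).comp (measurable_pi_apply k)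
  · simp_rw [hint _ hg]
    refine tendsto_nhds_unique (f := fun n => ∫⁻ y : ℕ → ℕ × (ℕ → E), ∏ k ∈ Finset.range n,
      expNeg (∑ i ∈ Finset.range (y k).1, g ((y k).2 i)) ∂(Measure.infinitePi fun k =>
        (poissonMeasure (r k)).prod (Measure.infinitePi fun _ => p k))) (l := atTop) ?_ ?_
    · refine tendsto_lintegral_of_dominated_convergence (fun _ => 1) (fun n => ?_) (fun n => ?_)
        (by simp) (ae_of_all _ fun y => tendsto_prod_expNeg _)
      · exact Finset.measurable_fun_prod _ fun k _ =>
          measurable_expNeg.comp ((hm hg).comp (measurable_pi_apply k))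
      · exact ae_of_all _ fun y => Finset.prod_le_one' fun k _ => expNeg_le_one _
    · have h1 (n : ℕ) : ∫⁻ y : ℕ → ℕ × (ℕ → E), ∏ k ∈ Finset.range n,
          expNeg (∑ i ∈ Finset.range (y k).1, g ((y k).2 i)) ∂(Measure.infinitePi fun k =>
          (poissonMeasure (r k)).prod (Measure.infinitePi fun _ => p k)) =
          ∏ k ∈ Finset.range n, expNeg (∫⁻ x, (1 - expNeg (g x)) ∂(sfiniteSeq m k)) := by
        rw [lintegral_prod_eq_prod_lintegral_of_indepFun _
          (fun k (y : ℕ → ℕ × (ℕ → E)) => expNeg (∑ i ∈ Finset.range (y k).1, g ((y k).2 i)))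
          (iIndepFun_infinitePi
            (X := fun _ (x : ℕ × (ℕ → E)) => expNeg (∑ i ∈ Finset.range x.1, g (x.2 i)))
            fun k => measurable_expNeg.comp (hm hg))
          fun k => measurable_expNeg.comp ((hm hg).comp (measurable_pi_apply k))]
        refine Finset.prod_congr rfl fun k _ => ?_
        conv_rhs => rw [hrp k]
        rw [show (r k • p k) = ((r k : ℝ≥0∞) • p k) from rfl, lintegral_smul_measure, smul_eq_mul,
          ← lintegral_expNeg_compoundPoisson (r k) (p k) hg,
          ← Measure.infinitePi_map_eval (fun k : ℕ =>
            (poissonMeasure (r k)).prod (Measure.infinitePi fun _ => p k)) k,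
          lintegral_map (f := fun x : ℕ × (ℕ → E) => expNeg (∑ i ∈ Finset.range x.1, g (x.2 i)))
            (measurable_expNeg.comp (hm hg)) (by fun_prop)]
      simp_rw [h1]
      conv => enter [3, 1]; rw [← sum_sfiniteSeq m, lintegral_sum_measure]
      exact tendsto_prod_expNeg _

/-! ### Bernstein functions and Lévy random measures -/

lemma expNeg_ofReal_mul {u z : ℝ} (hu : 0 ≤ u) (hz : 0 ≤ z) :
    expNeg (.ofReal u * .ofReal z) = .ofReal (Real.exp (-(u * z))) := by
  rw [← ENNReal.ofReal_mul hu, expNeg_ofReal (mul_nonneg hu hz)]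

lemma one_sub_exp_neg_le {u t : ℝ} (hu : 0 ≤ u) (ht : 0 ≤ t) :
    1 - Real.exp (-(u * t)) ≤ (1 + u) * min 1 t := by
  have h1 : 1 - Real.exp (-(u * t)) ≤ 1 := by linarith [Real.exp_pos (-(u * t))]
  have h2 : 1 - Real.exp (-(u * t)) ≤ u * t := by linarith [Real.add_one_le_exp (-(u * t))]
  rcases le_total 1 t with h | h
  · rw [min_eq_left h]; linarith
  · rw [min_eq_right h]; linarith

lemma one_sub_exp_neg_nonneg {u t : ℝ} (hu : 0 ≤ u) (ht : 0 ≤ t) :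
    0 ≤ 1 - Real.exp (-(u * t)) := by
  have := Real.exp_le_one_iff.2 (neg_nonpos.2 (mul_nonneg hu ht))
  linarith

lemma ae_pos_of_null_Iic {ν : Measure ℝ} (hν : ν (Iic 0) = 0) : ∀ᵐ t ∂ν, 0 < t := by
  rw [ae_iff]; convert hν using 2; ext; simp

lemma integrable_min_one {ν : Measure ℝ} (hν : ν (Iic 0) = 0)
    (hint : ∫⁻ t, ENNReal.ofReal (min 1 t) ∂ν < ∞) : Integrable (fun t => min 1 t) ν := by
  refine ⟨by fun_prop, ?_⟩
  rw [hasFiniteIntegral_iff_ofReal]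
  · exact hint
  · filter_upwards [ae_pos_of_null_Iic hν] with t ht
    exact le_min zero_le_one ht.le

lemma integrable_one_sub_exp_neg {ν : Measure ℝ} (hν : ν (Iic 0) = 0)
    (hint : ∫⁻ t, ENNReal.ofReal (min 1 t) ∂ν < ∞) {u : ℝ} (hu : 0 ≤ u) :
    Integrable (fun t => 1 - Real.exp (-(u * t))) ν := by
  refine Integrable.mono' ((integrable_min_one hν hint).const_mul (1 + u)) (by fun_prop) ?_
  filter_upwards [ae_pos_of_null_Iic hν] with t ht
  rw [Real.norm_of_nonneg (one_sub_exp_neg_nonneg hu ht.le)]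
  exact one_sub_exp_neg_le hu ht.le

lemma sFinite_of_lintegral_min_one {ν : Measure ℝ} (hν : ν (Iic 0) = 0)
    (hint : ∫⁻ t, ENNReal.ofReal (min 1 t) ∂ν < ∞) : SFinite ν := by
  have : IsFiniteMeasure (ν.withDensity fun t => ENNReal.ofReal (min 1 t)) :=
    isFiniteMeasure_withDensity hint.ne
  rw [← withDensity_inv_same (μ := ν) (f := fun t => ENNReal.ofReal (min 1 t)) (by fun_prop)]
  · infer_instance
  · filter_upwards [ae_pos_of_null_Iic hν] with t ht
    simp [ht]
  · exact ae_of_all _ fun t => ENNReal.ofReal_ne_top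

/-- The Bernstein function with drift `a` and Lévy measure `ν`, extended to `[0, ∞]`. -/
noncomputable def levyExponent (a : ℝ≥0) (ν : Measure ℝ) (x : ℝ≥0∞) : ℝ≥0∞ :=
  a * x + ∫⁻ z, (1 - expNeg (x * .ofReal z)) ∂ν

@[simp] lemma levyExponent_zero (a : ℝ≥0) (ν : Measure ℝ) : levyExponent a ν 0 = 0 := by
  simp [levyExponent]

lemma measurable_levyExponent (a : ℝ≥0) (ν : Measure ℝ) [SFinite ν] :
    Measurable (levyExponent a ν) := by
  refine (by fun_prop : Measurable fun x : ℝ≥0∞ => (a : ℝ≥0∞) * x).add ?_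
  exact Measurable.lintegral_prod_right' (f := fun p : ℝ≥0∞ × ℝ => 1 - expNeg (p.1 * .ofReal p.2))
    (by fun_prop)

lemma levyExponent_ofReal (a : ℝ≥0) {ν : Measure ℝ} (hν : ν (Iic 0) = 0)
    (hint : ∫⁻ t, ENNReal.ofReal (min 1 t) ∂ν < ∞) {u : ℝ} (hu : 0 ≤ u) :
    levyExponent a ν (.ofReal u) = .ofReal (a * u + ∫ t, (1 - Real.exp (-(u * t))) ∂ν) := by
  have hnn : 0 ≤ᵐ[ν] fun t => 1 - Real.exp (-(u * t)) := by
    filter_upwards [ae_pos_of_null_Iic hν] with t ht using one_sub_exp_neg_nonneg hu ht.le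
  rw [levyExponent, ENNReal.ofReal_add (by positivity) (integral_nonneg_of_ae hnn),
    ofReal_integral_eq_lintegral_ofReal (integrable_one_sub_exp_neg hν hint hu) hnn,
    ENNReal.ofReal_mul a.coe_nonneg, ENNReal.ofReal_coe_nnreal]
  congr 1
  refine lintegral_congr_ae ?_
  filter_upwards [ae_pos_of_null_Iic hν] with t ht
  rw [expNeg_ofReal_mul hu ht.le, ENNReal.ofReal_sub _ (Real.exp_pos _).le, ENNReal.ofReal_one]

/-- A Bernstein function vanishes at `0` continuously from the right. -/
lemma tendsto_levyExponent_inv (a : ℝ≥0) {ν : Measure ℝ} (hν : ν (Iic 0) = 0)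
    (hint : ∫⁻ t, ENNReal.ofReal (min 1 t) ∂ν < ∞) :
    Tendsto (fun n : ℕ => levyExponent a ν (.ofReal (1 / (n + 1)))) atTop (𝓝 0) := by
  have h0 (n : ℕ) : (0 : ℝ) ≤ 1 / (n + 1) := by positivity
  simp_rw [fun n => levyExponent_ofReal a hν hint (h0 n)]
  rw [← ENNReal.ofReal_zero]
  refine ENNReal.tendsto_ofReal ?_
  rw [show (0 : ℝ) = a * 0 + ∫ t, (1 - Real.exp (-(0 * t))) ∂ν by simp]
  have hlim := tendsto_one_div_add_atTop_nhds_zero_nat (𝕜 := ℝ)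
  refine (hlim.const_mul _).add (tendsto_integral_of_dominated_convergence
    (fun t => 2 * min 1 t) (fun n => by fun_prop) ((integrable_min_one hν hint).const_mul 2)
    (fun n => ?_) (ae_of_all _ fun t => ?_))
  · filter_upwards [ae_pos_of_null_Iic hν] with t ht
    rw [Real.norm_of_nonneg (one_sub_exp_neg_nonneg (h0 n) ht.le)]
    refine (one_sub_exp_neg_le (h0 n) ht.le).trans ?_
    gcongr
    have : (1 : ℝ) / (n + 1) ≤ 1 := by
      rw [div_le_one (by positivity)]; linarith [n.cast_nonneg (α := ℝ)]
    linarith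
  · have hc : Continuous fun u : ℝ => 1 - Real.exp (-(u * t)) := by fun_prop
    exact (hc.tendsto 0).comp hlim

/-- Lebesgue measure on `[0, ∞)`, as the image of Lebesgue measure on `(0, ∞) ⊆ ℝ`. -/
noncomputable def lebesgueNNReal : Measure ℝ≥0 :=
  (volume.restrict (Ioi (0 : ℝ))).map Real.toNNReal

instance : SFinite lebesgueNNReal := by unfold lebesgueNNReal; infer_instance

lemma lintegral_lebesgueNNReal {g : ℝ≥0 → ℝ≥0∞} (hg : Measurable g) :
    ∫⁻ s, g s ∂lebesgueNNReal = ∫⁻ x in Ioi (0 : ℝ), g x.toNNReal :=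
  lintegral_map hg (by fun_prop)

lemma lebesgueNNReal_Ioc (s t : ℝ≥0) : lebesgueNNReal (Ioc s t) = t - s := by
  rw [lebesgueNNReal, Measure.map_apply (by fun_prop) measurableSet_Ioc,
    Measure.restrict_apply (measurableSet_Ioc.preimage (by fun_prop))]
  have : Real.toNNReal ⁻¹' Ioc s t ∩ Ioi 0 = Ioc (s : ℝ) t := by
    ext x
    simp only [mem_inter_iff, mem_preimage, mem_Ioc, mem_Ioi, Real.lt_toNNReal_iff_coe_lt,
      Real.toNNReal_le_iff_le_coe]
    exact ⟨fun h => h.1, fun h => ⟨h, lt_of_le_of_lt s.coe_nonneg h.1⟩⟩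
  rw [this, Real.volume_Ioc, ENNReal.ofReal_sub _ s.coe_nonneg]
  simp

/-- `M` is the jump-and-drift measure `dX_t` of a subordinator with drift `a` and Lévy measure `ν`:
a random measure on the time axis `[0, ∞)` whose Laplace functional is
`E exp(-∫ h dM) = exp(-∫_0^∞ F(h(s)) ds)` with `F` the Bernstein function of `(a, ν)`. -/
structure IsLevyRandomMeasure {Ω : Type*} [MeasurableSpace Ω] (a : ℝ≥0) (ν : Measure ℝ)
    (P : Measure Ω) (M : Ω → Measure ℝ≥0) : Prop where
  measurable_lintegral : ∀ h : ℝ≥0 → ℝ≥0∞, Measurable h → Measurable fun ω => ∫⁻ s, h s ∂(M ω)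
  lintegral_expNeg : ∀ h : ℝ≥0 → ℝ≥0∞, Measurable h →
    ∫⁻ ω, expNeg (∫⁻ s, h s ∂(M ω)) ∂P = expNeg (∫⁻ s, levyExponent a ν (h s) ∂lebesgueNNReal)

/-- Lévy–Itô construction: the atoms of a Poisson random measure on (time) × (jump size) with
intensity `ds ν(dz)`, weighted by their jump sizes, on top of the drift `a ds`. -/
theorem exists_isLevyRandomMeasure (a : ℝ≥0) (ν : Measure ℝ) [SFinite ν] :
    ∃ (Ω : Type) (_ : MeasurableSpace Ω) (P : Measure Ω) (M : Ω → Measure ℝ≥0),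
      IsProbabilityMeasure P ∧ IsLevyRandomMeasure a ν P M := by
  obtain ⟨Ω, mΩ, P, N, hP, hN, hN'⟩ := exists_poissonRandomMeasure (lebesgueNNReal.prod ν)
  have hint (ω : Ω) {h : ℝ≥0 → ℝ≥0∞} (hh : Measurable h) :
      ∫⁻ s, h s ∂((a : ℝ≥0∞) • lebesgueNNReal +
        ((N ω).withDensity fun p => .ofReal p.2).map Prod.fst) =
      a * ∫⁻ s, h s ∂lebesgueNNReal + ∫⁻ p, h p.1 * .ofReal p.2 ∂(N ω) := by
    rw [lintegral_add_measure, lintegral_smul_measure, smul_eq_mul,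
      lintegral_map hh measurable_fst,
      lintegral_withDensity_eq_lintegral_mul _ (by fun_prop) (by fun_prop)]
    simp only [Pi.mul_apply, mul_comm]
  refine ⟨Ω, mΩ, P, fun ω => (a : ℝ≥0∞) • lebesgueNNReal +
    ((N ω).withDensity fun p => .ofReal p.2).map Prod.fst, hP, ⟨fun h hh => ?_, fun h hh => ?_⟩⟩
  · simp_rw [hint _ hh]
    exact (hN (fun p => h p.1 * .ofReal p.2) (by fun_prop)).const_add _
  · simp_rw [hint _ hh, expNeg_add]
    rw [lintegral_const_mul' _ _ (expNeg_ne_top _),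
      hN' (fun p => h p.1 * .ofReal p.2) (by fun_prop), ← expNeg_add,
      lintegral_prod _ (by fun_prop)]
    simp only [levyExponent]
    rw [lintegral_add_left (by fun_prop), lintegral_const_mul _ hh]

lemma measurable_measure_apply {Ω : Type*} [MeasurableSpace Ω] {a : ℝ≥0} {ν : Measure ℝ}
    {P : Measure Ω} {M : Ω → Measure ℝ≥0} (hM : IsLevyRandomMeasure a ν P M) {A : Set ℝ≥0}
    (hA : MeasurableSet A) : Measurable fun ω => M ω A := by
  have := hM.measurable_lintegral (A.indicator 1) (by fun_prop)
  simpa [lintegral_indicator_one hA] using this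

/-- The joint Laplace transform of the masses of disjoint sets. -/
lemma IsLevyRandomMeasure.lintegral_expNeg_sum {Ω : Type*} [MeasurableSpace Ω] {a : ℝ≥0}
    {ν : Measure ℝ} [SFinite ν] {P : Measure Ω} {M : Ω → Measure ℝ≥0}
    (hM : IsLevyRandomMeasure a ν P M) {ι : Type*} [Fintype ι] {A : ι → Set ℝ≥0}
    (hA : ∀ i, MeasurableSet (A i)) (hd : Pairwise fun i j => Disjoint (A i) (A j))
    (u : ι → ℝ≥0∞) :
    ∫⁻ ω, expNeg (∑ i, u i * M ω (A i)) ∂P =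
      ∏ i, expNeg (levyExponent a ν (u i) * lebesgueNNReal (A i)) := by
  have h1 (m : Measure ℝ≥0) (v : ι → ℝ≥0∞) :
      ∫⁻ s, ∑ i, (A i).indicator (fun _ => v i) s ∂m = ∑ i, v i * m (A i) := by
    rw [lintegral_finsetSum _ fun i _ => measurable_const.indicator (hA i)]
    simp [lintegral_indicator (hA _)]
  have h2 (s : ℝ≥0) : levyExponent a ν (∑ i, (A i).indicator (fun _ => u i) s) =
      ∑ i, (A i).indicator (fun _ => levyExponent a ν (u i)) s := by
    by_cases hs : ∃ i, s ∈ A i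
    · obtain ⟨i, hi⟩ := hs
      have hne (j : ι) (hj : j ≠ i) : s ∉ A j := fun h => (hd hj).le_bot ⟨h, hi⟩
      rw [Finset.sum_eq_single i (fun j _ hj => by simp [hne j hj]) (by simp),
        Finset.sum_eq_single i (fun j _ hj => by simp [hne j hj]) (by simp)]
      simp [hi]
    · push Not at hs
      simp [hs]
  rw [← expNeg_sum, ← h1, ← lintegral_congr h2, ← hM.lintegral_expNeg]
  · simp_rw [h1]
  · exact Finset.measurable_fun_sum _ fun i _ => measurable_const.indicator (hA i)

lemma IsLevyRandomMeasure.lintegral_expNeg_apply {Ω : Type*} [MeasurableSpace Ω] {a : ℝ≥0}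
    {ν : Measure ℝ} [SFinite ν] {P : Measure Ω} {M : Ω → Measure ℝ≥0}
    (hM : IsLevyRandomMeasure a ν P M) {A : Set ℝ≥0} (hA : MeasurableSet A) (u : ℝ≥0∞) :
    ∫⁻ ω, expNeg (u * M ω A) ∂P = expNeg (levyExponent a ν u * lebesgueNNReal A) := by
  simpa using hM.lintegral_expNeg_sum (ι := Unit) (A := fun _ => A) (fun _ => hA)
    (fun i j h => (h (Subsingleton.elim i j)).elim) (fun _ => u)

/-- The masses of disjoint sets are independent. -/
lemma IsLevyRandomMeasure.iIndepFun {Ω : Type*} [MeasurableSpace Ω] {a : ℝ≥0}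
    {ν : Measure ℝ} [SFinite ν] {P : Measure Ω} [IsProbabilityMeasure P] {M : Ω → Measure ℝ≥0}
    (hM : IsLevyRandomMeasure a ν P M) {ι : Type*} [Fintype ι] {A : ι → Set ℝ≥0}
    (hA : ∀ i, MeasurableSet (A i)) (hd : Pairwise fun i j => Disjoint (A i) (A j)) :
    iIndepFun (fun i ω => M ω (A i)) P := by
  refine iIndepFun_of_lintegral_expNeg (fun i => measurable_measure_apply hM (hA i)) fun u => ?_
  rw [hM.lintegral_expNeg_sum hA hd fun i => (u i : ℝ≥0∞)]
  simp_rw [hM.lintegral_expNeg_apply (hA _)]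

/-- A `[0, ∞]`-valued random variable whose Laplace transform tends to `1` at `0` is finite. -/
lemma ae_lt_top_of_tendsto_expNeg {Ω : Type*} [MeasurableSpace Ω] {P : Measure Ω}
    [IsProbabilityMeasure P] {Y : Ω → ℝ≥0∞} (hY : Measurable Y) {v : ℕ → ℝ≥0∞}
    (hv : ∀ n, v n ≠ 0)
    (h : Tendsto (fun n => ∫⁻ ω, expNeg (v n * Y ω) ∂P) atTop (𝓝 1)) : ∀ᵐ ω ∂P, Y ω < ∞ := by
  have hm : MeasurableSet {ω | Y ω < ∞} := measurableSet_lt hY measurable_const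
  have : 1 ≤ P {ω | Y ω < ∞} := by
    refine le_of_tendsto' h fun n => ?_
    rw [← lintegral_indicator_one hm]
    refine lintegral_mono fun ω => ?_
    by_cases hω : Y ω < ∞
    · simpa [hω] using expNeg_le_one _
    · simp [not_lt_top_iff.1 hω, ENNReal.mul_top (hv n)]
  rw [ae_iff, ← compl_ofPred, prob_compl_eq_zero_iff hm]
  exact le_antisymm prob_le_one this

lemma IsLevyRandomMeasure.ae_lt_top {Ω : Type*} [MeasurableSpace Ω] {a : ℝ≥0}
    {ν : Measure ℝ} {P : Measure Ω} [IsProbabilityMeasure P] {M : Ω → Measure ℝ≥0}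
    (hM : IsLevyRandomMeasure a ν P M) (hν : ν (Iic 0) = 0)
    (hint : ∫⁻ t, ENNReal.ofReal (min 1 t) ∂ν < ∞) :
    ∀ᵐ ω ∂P, ∀ t : ℝ≥0, M ω (Ioc 0 t) < ∞ := by
  have := sFinite_of_lintegral_min_one hν hint
  have h1 : ∀ᵐ ω ∂P, ∀ n : ℕ, M ω (Ioc 0 (n : ℝ≥0)) < ∞ := by
    refine ae_all_iff.2 fun N => ?_
    refine ae_lt_top_of_tendsto_expNeg (measurable_measure_apply hM measurableSet_Ioc)
      (v := fun n => .ofReal (1 / (n + 1))) (fun n => by simp; positivity) ?_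
    simp_rw [hM.lintegral_expNeg_apply measurableSet_Ioc, lebesgueNNReal_Ioc]
    rw [← expNeg_zero]
    refine (continuous_expNeg.tendsto 0).comp ?_
    have := ENNReal.Tendsto.mul_const (b := ((N : ℝ≥0) : ℝ≥0∞) - (0 : ℝ≥0))
      (tendsto_levyExponent_inv a hν hint) (Or.inr (by simp))
    simpa using this
  filter_upwards [h1] with ω hω t
  obtain ⟨n, hn⟩ := exists_nat_ge t
  exact (measure_mono (Ioc_subset_Ioc_right hn)).trans_lt (hω n)

/-! ### Subordinators from random measures -/

lemma monotone_toReal_Ioc {m : Measure ℝ≥0} (hm : ∀ t, m (Ioc 0 t) < ∞) :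
    Monotone fun t => (m (Ioc 0 t)).toReal := fun _ t h =>
  ENNReal.toReal_mono (hm t).ne (measure_mono (Ioc_subset_Ioc_right h))

lemma toReal_Ioc_sub {m : Measure ℝ≥0} (hm : ∀ t, m (Ioc 0 t) < ∞)
    {s t : ℝ≥0} (hst : s ≤ t) :
    (m (Ioc 0 t)).toReal - (m (Ioc 0 s)).toReal = (m (Ioc s t)).toReal := by
  rw [← Ioc_union_Ioc_eq_Ioc zero_le hst, measure_union
    (Set.disjoint_left.2 fun x hx hy => not_lt.2 hx.2 hy.1) measurableSet_Ioc,
    ENNReal.toReal_add (hm s).ne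
    ((measure_mono (Ioc_subset_Ioc_left zero_le)).trans_lt (hm t)).ne]
  ring

lemma continuousWithinAt_toReal_Ioc {m : Measure ℝ≥0} (hm : ∀ t, m (Ioc 0 t) < ∞)
    (t : ℝ≥0) :
    ContinuousWithinAt (fun t => (m (Ioc 0 t)).toReal) (Ici t) t := by
  rw [← continuousWithinAt_Ioi_iff_Ici]
  refine (ENNReal.tendsto_toReal (hm t).ne).comp ?_
  have := tendsto_measure_biInter_gt (μ := m) (s := fun r => Ioc 0 r) (a := t)
    (fun r _ => measurableSet_Ioc.nullMeasurableSet) (fun i j _ hij => Ioc_subset_Ioc_right hij)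
    ⟨t + 1, by simp, (hm _).ne⟩
  convert! this using 2
  congr 1
  ext x
  simp only [mem_Ioc, mem_iInter]
  exact ⟨fun h r hr => ⟨h.1, h.2.trans hr.le⟩, fun h => ⟨(h (t + 1) (by simp)).1,
    le_of_forall_gt_imp_ge_of_dense fun r hr => (h r hr).2⟩⟩

/-- The Lebesgue–Stieltjes measure of the distribution function of `m` is `m` on `(0, ∞)`. -/
lemma pathMeasure_toReal_Ioc {m : Measure ℝ≥0} (hm : ∀ t, m (Ioc 0 t) < ∞) :
    (pathMeasure fun t => (m (Ioc 0 t)).toReal).restrict (Ioi 0) = m.restrict (Ioi 0) := by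
  have hF : Monotone (fun t => (m (Ioc 0 t)).toReal) ∧
      ∀ t, ContinuousWithinAt (fun t => (m (Ioc 0 t)).toReal) (Ici t) t :=
    ⟨monotone_toReal_Ioc hm, continuousWithinAt_toReal_Ioc hm⟩
  have hIoc (s t : ℝ≥0) : (pathMeasure fun t => (m (Ioc 0 t)).toReal) (Ioc s t) = m (Ioc s t) := by
    rcases le_total s t with hst | hst
    · rw [pathMeasure, dif_pos hF, StieltjesFunction.measure_Ioc]
      change ENNReal.ofReal ((m (Ioc 0 t)).toReal - (m (Ioc 0 s)).toReal) = _
      rw [toReal_Ioc_sub hm hst, ENNReal.ofReal_toReal]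
      exact ((measure_mono (Ioc_subset_Ioc_left zero_le)).trans_lt (hm t)).ne
    · simp [hst]
  -- transport to the real line, where half-open intervals determine a locally finite measure
  have he : MeasurableEmbedding ((↑) : ℝ≥0 → ℝ) :=
    MeasurableEmbedding.subtype_coe measurableSet_Ici
  have hpre (s t : ℝ) : ((↑) : ℝ≥0 → ℝ) ⁻¹' Ioc s t ∩ Ioi 0 = Ioc s.toNNReal t.toNNReal := by
    ext x
    simp only [mem_inter_iff, mem_preimage, mem_Ioc, mem_Ioi]
    rw [← NNReal.coe_lt_coe, ← NNReal.coe_le_coe, ← NNReal.coe_lt_coe, Real.coe_toNNReal',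
      Real.coe_toNNReal', max_lt_iff, le_max_iff, NNReal.coe_zero]
    constructor
    · rintro ⟨⟨h1, h2⟩, h3⟩
      exact ⟨⟨h1, h3⟩, Or.inl h2⟩
    · rintro ⟨⟨h1, h3⟩, h2 | h2⟩
      · exact ⟨⟨h1, h2⟩, h3⟩
      · exact absurd h3 (not_lt.2 h2)
  have hmap (k : Measure ℝ≥0) (s t : ℝ) :
      ((k.restrict (Ioi 0)).map ((↑) : ℝ≥0 → ℝ)) (Ioc s t) = k (Ioc s.toNNReal t.toNNReal) := by
    rw [Measure.map_apply (by fun_prop) measurableSet_Ioc,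
      Measure.restrict_apply (measurableSet_Ioc.preimage (by fun_prop)), hpre]
  have hext : ((pathMeasure fun t => (m (Ioc 0 t)).toReal).restrict (Ioi 0)).map
      ((↑) : ℝ≥0 → ℝ) = (m.restrict (Ioi 0)).map ((↑) : ℝ≥0 → ℝ) := by
    refine Measure.ext_of_Ioc' _ _ (fun s t _ => ?_) fun s t _ => ?_
    · rw [hmap, hIoc]
      exact ((measure_mono (Ioc_subset_Ioc_left zero_le)).trans_lt (hm t.toNNReal)).ne
    · rw [hmap, hmap, hIoc]
  have := congrArg (Measure.comap ((↑) : ℝ≥0 → ℝ)) hext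
  rwa [he.comap_map, he.comap_map] at this

/-- The process `X_t = M((0, t])` of a random measure `M`, with junk value `0` where the mass is
infinite. -/
noncomputable def distributionProcess {Ω : Type*} (M : Ω → Measure ℝ≥0) (t : ℝ≥0) (ω : Ω) : ℝ :=
  (M ω (Ioc 0 t)).toReal

lemma expIntegral_distributionProcess {Ω : Type*} {M : Ω → Measure ℝ≥0} {ω : Ω}
    (hω : ∀ t, M ω (Ioc 0 t) < ∞) :
    expIntegral (distributionProcess M) ω =
      ∫⁻ t, (Ioi (0 : ℝ≥0)).indicator (fun t => .ofReal (Real.exp (-(t : ℝ)))) t ∂(M ω) := by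
  rw [lintegral_indicator measurableSet_Ioi, expIntegral]
  simp only [distributionProcess]
  rw [pathMeasure_toReal_Ioc hω]

/-- The process `t ↦ M((0, t])` is a subordinator: its increments are the masses of disjoint
intervals. -/
theorem IsLevyRandomMeasure.isSubordinator {Ω : Type*} [MeasurableSpace Ω] {a : ℝ≥0}
    {ν : Measure ℝ} {P : Measure Ω} [IsProbabilityMeasure P] {M : Ω → Measure ℝ≥0}
    (hM : IsLevyRandomMeasure a ν P M) (hν : ν (Iic 0) = 0)
    (hint : ∫⁻ t, ENNReal.ofReal (min 1 t) ∂ν < ∞) :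
    IsSubordinator (distributionProcess M) P := by
  have := sFinite_of_lintegral_min_one hν hint
  have hfin := hM.ae_lt_top hν hint
  have hmeas (s t : ℝ≥0) : Measurable fun ω => M ω (Ioc s t) :=
    measurable_measure_apply hM measurableSet_Ioc
  have hsub (s t : ℝ≥0) (hst : s ≤ t) : (fun ω => (M ω (Ioc s t)).toReal) =ᵐ[P]
      fun ω => distributionProcess M t ω - distributionProcess M s ω := by
    filter_upwards [hfin] with ω hω
    exact (toReal_Ioc_sub hω hst).symm
  refine
    { measurable := fun t => (hmeas 0 t).ennreal_toReal
      start_zero := ae_of_all _ fun ω => by simp [distributionProcess]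
      indep_increments := fun n t ht => ?_
      stationary_increments := fun s h => ?_
      right_continuous := ?_
      left_limits := ?_
      nondecreasing := ?_ }
  · have h1 := hM.iIndepFun (A := fun i : Fin n => Ioc (t i.castSucc) (t i.succ))
      (fun i => measurableSet_Ioc) ?_
    · refine (h1.comp (fun _ => ENNReal.toReal) fun _ => ENNReal.measurable_toReal).congr
        fun i => ?_
      exact hsub _ _ (ht Fin.castSucc_lt_succ.le)
    · intro i j hij
      wlog hlt : i < j generalizing i j
      · exact (this hij.symm (lt_of_le_of_ne (not_lt.1 hlt) hij.symm)).symm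
      refine Set.disjoint_left.2 fun x hx hy => ?_
      exact absurd (hx.2.trans (ht (Fin.succ_le_castSucc_iff.2 hlt))) (not_le.2 hy.1)
  · have h1 : IdentDistrib (fun ω => M ω (Ioc s (s + h))) (fun ω => M ω (Ioc 0 h)) P P := by
      refine ⟨(hmeas _ _).aemeasurable, (hmeas _ _).aemeasurable, ?_⟩
      have := Measure.isProbabilityMeasure_map (μ := P) (hmeas s (s + h)).aemeasurable
      have := Measure.isProbabilityMeasure_map (μ := P) (hmeas 0 h).aemeasurable
      refine ext_of_lintegral_expNeg_eq_one_dim fun u => ?_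
      rw [lintegral_map (by fun_prop) (hmeas _ _), lintegral_map (by fun_prop) (hmeas _ _),
        hM.lintegral_expNeg_apply measurableSet_Ioc, hM.lintegral_expNeg_apply measurableSet_Ioc,
        lebesgueNNReal_Ioc, lebesgueNNReal_Ioc, ENNReal.coe_add,
        ENNReal.add_sub_cancel_left (by simp)]
      simp
    have h2 := h1.comp ENNReal.measurable_toReal
    exact ((IdentDistrib.of_ae_eq ((hmeas _ _).ennreal_toReal.aemeasurable)
      (hsub s (s + h) (by simp))).symm.trans h2).trans
      (IdentDistrib.of_ae_eq ((hmeas _ _).ennreal_toReal.aemeasurable) (hsub 0 h zero_le))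
  · filter_upwards [hfin] with ω hω using continuousWithinAt_toReal_Ioc hω
  · filter_upwards [hfin] with ω hω t
    exact ⟨_, (monotone_toReal_Ioc hω).tendsto_nhdsLT t⟩
  · filter_upwards [hfin] with ω hω using monotone_toReal_Ioc hω

/-- The Laplace transform of `∫_{(0,∞)} e^{-t} dX_t` is `u ↦ exp(-∫_0^∞ F(u e^{-s}) ds)`. -/
lemma IsLevyRandomMeasure.lintegral_expNeg_expIntegral {Ω : Type*} [MeasurableSpace Ω] {a : ℝ≥0}
    {ν : Measure ℝ} {P : Measure Ω} [IsProbabilityMeasure P] {M : Ω → Measure ℝ≥0}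
    (hM : IsLevyRandomMeasure a ν P M) (hν : ν (Iic 0) = 0)
    (hint : ∫⁻ t, ENNReal.ofReal (min 1 t) ∂ν < ∞) :
    AEMeasurable (expIntegral (distributionProcess M)) P ∧ ∀ u : ℝ, 0 ≤ u →
    ∫⁻ ω, expNeg (.ofReal u * expIntegral (distributionProcess M) ω) ∂P =
      expNeg (∫⁻ s in Ioi (0 : ℝ), levyExponent a ν (.ofReal (u * Real.exp (-s)))) := by
  have := sFinite_of_lintegral_min_one hν hint
  have hfin := hM.ae_lt_top hν hint
  set h : ℝ≥0 → ℝ≥0∞ := (Ioi (0 : ℝ≥0)).indicator fun t => .ofReal (Real.exp (-(t : ℝ))) with hh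
  have hhm : Measurable h := Measurable.indicator (by fun_prop) measurableSet_Ioi
  have heq : (fun ω => ∫⁻ t, h t ∂(M ω)) =ᵐ[P] expIntegral (distributionProcess M) := by
    filter_upwards [hfin] with ω hω using (expIntegral_distributionProcess hω).symm
  refine ⟨⟨_, hM.measurable_lintegral h hhm, heq.symm⟩, fun u hu => ?_⟩
  have h1 := hM.lintegral_expNeg (fun t => .ofReal u * h t) (by fun_prop)
  have hm1 : Measurable fun s => levyExponent a ν (.ofReal u * h s) :=
    (measurable_levyExponent a ν).comp (by fun_prop)
  rw [lintegral_lebesgueNNReal hm1] at h1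
  calc _ = ∫⁻ ω, expNeg (∫⁻ t, .ofReal u * h t ∂(M ω)) ∂P := by
        refine lintegral_congr_ae ?_
        filter_upwards [heq] with ω hω
        rw [lintegral_const_mul _ hhm, hω]
    _ = _ := h1
    _ = _ := by
      congr 1
      refine setLIntegral_congr_fun measurableSet_Ioi fun s hs => ?_
      have hs' : (0 : ℝ) < s := hs
      simp [hh, hs', ENNReal.ofReal_mul hu, hs'.le]

/-! ### Limits of Bernstein functions -/

lemma min_one_le_two_mul_one_sub_exp {t : ℝ} (ht : 0 ≤ t) :
    min 1 t ≤ 2 * (1 - Real.exp (-t)) := by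
  have h1 : Real.exp (-t) ≤ 1 / (1 + t) := by
    rw [Real.exp_neg, ← one_div]
    exact one_div_le_one_div_of_le (by linarith) (by linarith [Real.add_one_le_exp t])
  have h2 : min 1 t ≤ 2 * (1 - 1 / (1 + t)) := by
    have h3 : 1 - 1 / (1 + t) = t / (1 + t) := by field_simp; ring
    rw [h3, ← mul_div_assoc, le_div_iff₀ (by linarith)]
    rcases le_total 1 t with h | h
    · rw [min_eq_left h]; linarith
    · rw [min_eq_right h]; nlinarith
  linarith

/-- The continuous extension to `[0, 1]` of `y ↦ (1 - y^u) / (1 - y)`, for `u > 0`. -/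
noncomputable def powQuotient (u : ℝ) : ℝ → ℝ := dslope (fun y => y ^ u) 1

lemma continuous_powQuotient {u : ℝ} (hu : 0 < u) : Continuous (powQuotient u) := by
  rw [← continuousOn_univ, powQuotient, continuousOn_dslope univ_mem]
  exact ⟨(Real.continuous_rpow_const hu.le).continuousOn,
    (Real.hasDerivAt_rpow_const (Or.inl one_ne_zero)).differentiableAt⟩

lemma powQuotient_one (u : ℝ) : powQuotient u 1 = u := by
  rw [powQuotient, dslope_same,
    (Real.hasDerivAt_rpow_const (x := 1) (p := u) (Or.inl one_ne_zero)).deriv]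
  simp

lemma mul_powQuotient (u y : ℝ) : (1 - y) * powQuotient u y = 1 - y ^ u := by
  have := sub_smul_dslope (fun y : ℝ => y ^ u) 1 y
  simp only [smul_eq_mul, Real.one_rpow] at this
  rw [powQuotient]
  linarith

lemma powQuotient_nonneg {u y : ℝ} (hu : 0 ≤ u) (h0 : 0 ≤ y) (h1 : y ≤ 1) :
    0 ≤ powQuotient u y := by
  rcases h1.eq_or_lt with rfl | h1
  · rwa [powQuotient_one]
  · have := mul_powQuotient u y
    have h2 := Real.rpow_le_one h0 h1.le hu
    by_contra! h
    nlinarith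

/-- Representation of a Bernstein function on the compact interval `[0, 1] ∋ y = e^{-t}`: the mass
of `κ` at `1` is the drift, and `κ` must not charge `0`, which corresponds to `t = ∞`. -/
theorem isBernstein_of_integral_powQuotient (κ : Measure ℝ) [IsFiniteMeasure κ]
    (hκ : κ (Ioc 0 1)ᶜ = 0) {g : ℝ → ℝ} (h0 : g 0 = 0)
    (hg : ∀ u, 0 < u → g u = ∫ y, powQuotient u y ∂κ) : IsBernstein g := by
  have hmem : ∀ᵐ y ∂(κ.restrict (Iio 1)), y ∈ Ioo (0 : ℝ) 1 := by
    rw [ae_restrict_iff' measurableSet_Iio]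
    have : ∀ᵐ y ∂κ, y ∈ Ioc (0 : ℝ) 1 := by rw [ae_iff]; exact hκ
    filter_upwards [this] with y hy h1 using ⟨hy.1, h1⟩
  have hmlog : Measurable fun y : ℝ => -Real.log y := by fun_prop
  set w : ℝ → ℝ≥0∞ := fun y => .ofReal (1 / (1 - y)) with hw
  have hwm : Measurable w := by fun_prop
  set ν : Measure ℝ := ((κ.restrict (Iio 1)).withDensity w).map fun y => -Real.log y with hν
  have hνpos : ν (Iic 0) = 0 := by
    rw [hν, Measure.map_apply hmlog measurableSet_Iic]
    refine withDensity_absolutelyContinuous _ _ ?_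
    rw [← nonpos_iff_eq_zero]
    refine le_of_le_of_eq (measure_mono fun y hy => ?_) (ae_iff.1 hmem)
    intro hy'
    have := Real.log_neg hy'.1 hy'.2
    simp only [mem_preimage, mem_Iic] at hy
    linarith
  refine ⟨κ.real {1}, ν, measureReal_nonneg, hνpos, ?_, fun u hu => ?_⟩
  · rw [hν, lintegral_map (by fun_prop) hmlog,
      lintegral_withDensity_eq_lintegral_mul _ hwm (by fun_prop)]
    calc _ ≤ ∫⁻ y, ENNReal.ofReal 2 ∂(κ.restrict (Iio 1)) := by
          refine lintegral_mono_ae ?_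
          filter_upwards [hmem] with y hy
          have h1 : 0 < 1 - y := by linarith [hy.2]
          simp only [Pi.mul_apply, hw]
          rw [← ENNReal.ofReal_mul (by positivity)]
          refine ENNReal.ofReal_le_ofReal ?_
          have := min_one_le_two_mul_one_sub_exp (t := -Real.log y)
            (by linarith [Real.log_neg hy.1 hy.2])
          rw [neg_neg, Real.exp_log hy.1] at this
          calc _ ≤ 1 / (1 - y) * (2 * (1 - y)) := by gcongr
            _ = 2 := by field_simp
      _ < ∞ := by
          rw [lintegral_const]
          exact ENNReal.mul_lt_top (by simp) (measure_lt_top _ _)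
  · rcases hu.eq_or_lt with rfl | hu
    · simp [h0]
    have hint : Integrable (powQuotient u) κ := by
      obtain ⟨C, hC⟩ := (isCompact_Icc (a := (0 : ℝ)) (b := 1)).exists_bound_of_continuousOn
        (continuous_powQuotient hu).continuousOn
      refine Integrable.of_bound (continuous_powQuotient hu).aestronglyMeasurable C ?_
      have : ∀ᵐ y ∂κ, y ∈ Ioc (0 : ℝ) 1 := by rw [ae_iff]; exact hκ
      filter_upwards [this] with y hy using hC y ⟨hy.1.le, hy.2⟩
    have hIci : ∫ y in Ici 1, powQuotient u y ∂κ = κ.real {1} * u := by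
      have : κ.restrict (Ici 1) = κ.restrict {1} := by
        refine Measure.restrict_congr_set ?_
        have : ∀ᵐ y ∂κ, y ∈ Ioc (0 : ℝ) 1 := by rw [ae_iff]; exact hκ
        filter_upwards [this] with y hy
        exact propext ⟨fun h => le_antisymm hy.2 h, fun h => (show y = 1 from h).ge⟩
      rw [this, integral_singleton, powQuotient_one, smul_eq_mul]
    rw [hg u hu, ← integral_add_compl measurableSet_Iio hint, add_comm, compl_Iio, hIci, hν,
      integral_map hmlog.aemeasurable (by fun_prop),
      integral_withDensity_eq_integral_toReal_smul hwm (ae_of_all _ fun _ => ENNReal.ofReal_lt_top)]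
    congr 1
    refine integral_congr_ae ?_
    filter_upwards [hmem] with y hy
    have h1 : 0 < 1 - y := by linarith [hy.2]
    simp only [hw, smul_eq_mul]
    rw [ENNReal.toReal_ofReal (by positivity), show -(u * -Real.log y) = Real.log y * u by ring,
      ← Real.rpow_def_of_pos hy.1, ← mul_powQuotient]
    field_simp

/-- A pointwise limit of functions `u ↦ ∫ (1 - e^{-ut}) ν_n(dt)` that vanishes continuously at `0`
is a Bernstein function. The measures `(1 - e^{-t}) ν_n(dt)`, carried to `[0, 1]` by `y = e^{-t}`,
have bounded mass, so they have a weak limit point. -/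
theorem isBernstein_of_tendsto {ν : ℕ → Measure ℝ} [∀ n, IsFiniteMeasure (ν n)]
    (hν : ∀ n, ν n (Iio 0) = 0) {g : ℝ → ℝ}
    (h : ∀ u, 0 ≤ u → Tendsto (fun n => ∫ t, (1 - Real.exp (-(u * t))) ∂(ν n)) atTop (𝓝 (g u)))
    (h0 : Tendsto g (𝓝[>] 0) (𝓝 0)) : IsBernstein g := by
  have hae (n : ℕ) : ∀ᵐ t ∂(ν n), 0 ≤ t := by
    rw [ae_iff]; convert hν n using 2; ext; simp
  let w : ℝ → ℝ≥0∞ := fun t => .ofReal (1 - Real.exp (-t))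
  have hwm : Measurable w := by fun_prop
  let φ : ℝ → Icc (0 : ℝ) 1 := fun t => projIcc 0 1 zero_le_one (Real.exp (-t))
  have hφ : Continuous φ := continuous_projIcc.comp (by fun_prop)
  have hφ' {t : ℝ} (ht : 0 ≤ t) : (φ t : ℝ) = Real.exp (-t) := by
    rw [coe_projIcc, min_eq_right (by simpa using ht), max_eq_right (Real.exp_pos _).le]
  have hwint (n : ℕ) : ∫⁻ t, w t ∂(ν n) = .ofReal (∫ t, (1 - Real.exp (-(1 * t))) ∂(ν n)) := by
    simp only [one_mul]
    rw [ofReal_integral_eq_lintegral_ofReal]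
    · refine Integrable.of_bound (by fun_prop) 1 ?_
      filter_upwards [hae n] with t ht
      have := one_sub_exp_neg_nonneg zero_le_one ht
      rw [one_mul] at this
      rw [Real.norm_of_nonneg this]
      linarith [Real.exp_pos (-t)]
    · filter_upwards [hae n] with t ht
      simpa using ht
  have hfin (n : ℕ) : IsFiniteMeasure ((ν n).withDensity w) :=
    isFiniteMeasure_withDensity (by rw [hwint]; exact ENNReal.ofReal_ne_top)
  let κ (n : ℕ) : FiniteMeasure (Icc (0 : ℝ) 1) := ⟨((ν n).withDensity w).map φ, inferInstance⟩
  obtain ⟨C, hC⟩ := (h 1 zero_le_one).bddAbove_range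
  have hmass (n : ℕ) : (κ n).mass ≤ C.toNNReal := by
    rw [← ENNReal.coe_le_coe, FiniteMeasure.ennreal_mass]
    change ((ν n).withDensity w).map φ univ ≤ ENNReal.ofReal C
    rw [Measure.map_apply hφ.measurable MeasurableSet.univ, preimage_univ,
      withDensity_apply _ MeasurableSet.univ, setLIntegral_univ, hwint]
    exact ENNReal.ofReal_le_ofReal (hC ⟨n, rfl⟩)
  -- a free ultrafilter is used in place of a convergent subsequence
  obtain ⟨κ', -, hκ'⟩ := (isCompact_setOfPred_finiteMeasure_le_of_compactSpace
    (Icc (0 : ℝ) 1) C.toNNReal).ultrafilter_le_nhds ((hyperfilter ℕ).map κ)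
    (by
      rw [le_principal_iff]
      exact Filter.mem_map.2 (Filter.univ_mem' hmass))
  have hlim (u : ℝ) (hu : 0 < u) : g u = ∫ y, powQuotient u y ∂(κ' : Measure (Icc (0 : ℝ) 1)) := by
    let F : BoundedContinuousFunction (Icc (0 : ℝ) 1) ℝ := BoundedContinuousFunction.mkOfCompact
      ⟨fun y => powQuotient u y, (continuous_powQuotient hu).comp continuous_subtype_val⟩
    have h1 : Tendsto (fun n => ∫ y, F y ∂(κ n : Measure (Icc (0 : ℝ) 1))) (hyperfilter ℕ)
        (𝓝 (∫ y, F y ∂(κ' : Measure (Icc (0 : ℝ) 1)))) :=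
      (FiniteMeasure.tendsto_iff_forall_integral_tendsto.1 (show Tendsto κ (hyperfilter ℕ) (𝓝 κ')
        from hκ')) F
    have h2 (n : ℕ) : ∫ y, F y ∂(κ n : Measure (Icc (0 : ℝ) 1)) =
        ∫ t, (1 - Real.exp (-(u * t))) ∂(ν n) := by
      change ∫ y, F y ∂(((ν n).withDensity w).map φ) = _
      rw [integral_map hφ.measurable.aemeasurable F.continuous.aestronglyMeasurable,
        integral_withDensity_eq_integral_toReal_smul hwm
          (ae_of_all _ fun _ => ENNReal.ofReal_lt_top)]
      refine integral_congr_ae ?_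
      filter_upwards [hae n] with t ht
      have h3 : 0 ≤ 1 - Real.exp (-t) := by simpa using ht
      change (ENNReal.ofReal (1 - Real.exp (-t))).toReal * powQuotient u (φ t) = _
      rw [ENNReal.toReal_ofReal h3, hφ' ht, mul_powQuotient, ← Real.exp_mul]
      congr 2
      ring
    simp_rw [h2] at h1
    exact tendsto_nhds_unique ((h u hu.le).mono_left Nat.hyperfilter_le_atTop) h1
  -- `powQuotient u 0 = 1` for every `u > 0`, so an atom at `0` would stay in the limit `u → 0`
  have hzero : (κ' : Measure (Icc (0 : ℝ) 1)).real {⟨0, by simp⟩} = 0 := by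
    refine le_antisymm (ge_of_tendsto h0 ?_) measureReal_nonneg
    filter_upwards [self_mem_nhdsWithin] with u hu
    have hu : 0 < u := hu
    rw [hlim u hu]
    have hi : Integrable (fun y : Icc (0 : ℝ) 1 => powQuotient u y)
        (κ' : Measure (Icc (0 : ℝ) 1)) :=
      ((continuous_powQuotient hu).comp continuous_subtype_val).integrable_of_hasCompactSupport
        (HasCompactSupport.of_compactSpace _)
    have h1 : powQuotient u 0 = 1 := by
      have := mul_powQuotient u 0
      simpa [Real.zero_rpow hu.ne'] using this
    calc _ = ∫ y in {⟨0, by simp⟩}, powQuotient u y ∂(κ' : Measure (Icc (0 : ℝ) 1)) := by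
          rw [integral_singleton]; simp [h1]
      _ ≤ _ := setIntegral_le_integral hi
        (ae_of_all _ fun y => powQuotient_nonneg hu.le y.2.1 y.2.2)
  refine isBernstein_of_integral_powQuotient ((κ' : Measure (Icc (0 : ℝ) 1)).map Subtype.val)
    ?_ ?_ fun u hu => ?_
  · rw [Measure.map_apply measurable_subtype_coe measurableSet_Ioc.compl]
    rw [measureReal_eq_zero_iff] at hzero
    refine measure_mono_null (fun y hy => ?_) hzero
    have : ¬ (0 < (y : ℝ) ∧ (y : ℝ) ≤ 1) := hy
    have h3 : (y : ℝ) = 0 := by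
      by_contra h4
      exact this ⟨lt_of_le_of_ne y.2.1 (Ne.symm h4), y.2.2⟩
    exact Subtype.ext h3
  · have := h 0 le_rfl
    simp only [zero_mul, neg_zero, Real.exp_zero, sub_self, integral_zero] at this
    exact tendsto_nhds_unique this tendsto_const_nhds
  · rw [hlim u hu, integral_map measurable_subtype_coe.aemeasurable
      (continuous_powQuotient hu).aestronglyMeasurable]

/-! ### The Laplace exponent and the passage from selfdecomposability to `uψ'(u)` -/

lemma ae_nonneg_of_null_Iio {μ : Measure ℝ} (hμ : μ (Iio 0) = 0) : ∀ᵐ x ∂μ, 0 ≤ x := by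
  rw [ae_iff]; convert hμ using 2; ext; simp

section LaplaceExponent

variable {μ : Measure ℝ} [IsProbabilityMeasure μ]

lemma integrable_exp_neg_mul (hμ : μ (Iio 0) = 0) {u : ℝ} (hu : 0 ≤ u) :
    Integrable (fun x => Real.exp (-(u * x))) μ := by
  refine Integrable.of_bound (by fun_prop) 1 ?_
  filter_upwards [ae_nonneg_of_null_Iio hμ] with x hx
  rw [Real.norm_of_nonneg (Real.exp_pos _).le]
  exact Real.exp_le_one_iff.2 (neg_nonpos.2 (mul_nonneg hu hx))

lemma laplace_pos (hμ : μ (Iio 0) = 0) {u : ℝ} (hu : 0 ≤ u) :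
    0 < ∫ x, Real.exp (-(u * x)) ∂μ :=
  integral_exp_pos (integrable_exp_neg_mul hμ hu)

lemma exp_neg_laplaceExponent (hμ : μ (Iio 0) = 0) {u : ℝ} (hu : 0 ≤ u) :
    Real.exp (-laplaceExponent μ u) = ∫ x, Real.exp (-(u * x)) ∂μ := by
  rw [laplaceExponent, neg_neg, Real.exp_log (laplace_pos hμ hu)]

lemma lintegral_expNeg_mul_ofReal {u : ℝ} (hμ : μ (Iio 0) = 0) (hu : 0 ≤ u) :
    ∫⁻ x, expNeg (.ofReal u * .ofReal x) ∂μ = .ofReal (Real.exp (-laplaceExponent μ u)) := by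
  rw [exp_neg_laplaceExponent hμ hu, ofReal_integral_eq_lintegral_ofReal
    (integrable_exp_neg_mul hμ hu) (ae_of_all _ fun x => (Real.exp_pos _).le)]
  refine lintegral_congr_ae ?_
  filter_upwards [ae_nonneg_of_null_Iio hμ] with x hx using expNeg_ofReal_mul hu hx

@[simp] lemma laplaceExponent_zero : laplaceExponent μ 0 = 0 := by simp [laplaceExponent]

lemma laplaceExponent_nonneg (hμ : μ (Iio 0) = 0) {u : ℝ} (hu : 0 ≤ u) :
    0 ≤ laplaceExponent μ u := by
  rw [laplaceExponent, neg_nonneg]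
  refine Real.log_nonpos (laplace_pos hμ hu).le ?_
  calc _ ≤ ∫ x, (1 : ℝ) ∂μ := by
        refine integral_mono_ae (integrable_exp_neg_mul hμ hu) (integrable_const _) ?_
        filter_upwards [ae_nonneg_of_null_Iio hμ] with x hx
        exact Real.exp_le_one_iff.2 (neg_nonpos.2 (mul_nonneg hu hx))
    _ = 1 := by simp

lemma hasDerivAt_laplace (hμ : μ (Iio 0) = 0) {u : ℝ} (hu : 0 < u) :
    HasDerivAt (fun v => ∫ x, Real.exp (-(v * x)) ∂μ) (-∫ x, x * Real.exp (-(u * x)) ∂μ) u := by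
  have hmem : -u ∈ interior (integrableExpSet id μ) := by
    refine mem_interior.2 ⟨Iio 0, fun v hv => ?_, isOpen_Iio, by simpa using hu⟩
    have := integrable_exp_neg_mul hμ (u := -v) (by simpa using (le_of_lt hv))
    simpa [integrableExpSet] using this
  have := (hasDerivAt_mgf hmem).comp u (hasDerivAt_neg u)
  simpa [mgf, Function.comp_def] using this

lemma hasDerivAt_laplaceExponent (hμ : μ (Iio 0) = 0) {u : ℝ} (hu : 0 < u) :
    HasDerivAt (laplaceExponent μ)
      ((∫ x, x * Real.exp (-(u * x)) ∂μ) / ∫ x, Real.exp (-(u * x)) ∂μ) u := by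
  have := ((hasDerivAt_laplace hμ hu).log (laplace_pos hμ hu.le).ne').neg
  rwa [neg_div, neg_neg] at this

lemma deriv_laplaceExponent (hμ : μ (Iio 0) = 0) {u : ℝ} (hu : 0 < u) :
    deriv (laplaceExponent μ) u =
      (∫ x, x * Real.exp (-(u * x)) ∂μ) / ∫ x, Real.exp (-(u * x)) ∂μ :=
  (hasDerivAt_laplaceExponent hμ hu).deriv

lemma deriv_laplaceExponent_nonneg (hμ : μ (Iio 0) = 0) {u : ℝ} (hu : 0 < u) :
    0 ≤ deriv (laplaceExponent μ) u := by
  rw [deriv_laplaceExponent hμ hu]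
  refine div_nonneg (integral_nonneg_of_ae ?_) (laplace_pos hμ hu.le).le
  filter_upwards [ae_nonneg_of_null_Iio hμ] with x hx using mul_nonneg hx (Real.exp_pos _).le

lemma tendsto_laplace_nhdsGT_zero (hμ : μ (Iio 0) = 0) :
    Tendsto (fun u => ∫ x, Real.exp (-(u * x)) ∂μ) (𝓝[>] 0) (𝓝 1) := by
  rw [show (1 : ℝ) = ∫ x, Real.exp (-(0 * x)) ∂μ by simp]
  refine tendsto_integral_filter_of_dominated_convergence (fun _ => 1)
    (Eventually.of_forall fun u => by fun_prop) ?_ (by simp) (ae_of_all _ fun x => ?_)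
  · filter_upwards [self_mem_nhdsWithin] with u hu
    filter_upwards [ae_nonneg_of_null_Iio hμ] with x hx
    rw [Real.norm_of_nonneg (Real.exp_pos _).le]
    exact Real.exp_le_one_iff.2 (neg_nonpos.2 (mul_nonneg (le_of_lt hu) hx))
  · have : Continuous fun u => Real.exp (-(u * x)) := by fun_prop
    exact (this.tendsto 0).mono_left nhdsWithin_le_nhds

lemma tendsto_laplaceExponent_nhdsGT_zero (hμ : μ (Iio 0) = 0) :
    Tendsto (laplaceExponent μ) (𝓝[>] 0) (𝓝 0) := by
  have := ((tendsto_laplace_nhdsGT_zero hμ).log one_ne_zero).neg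
  rwa [Real.log_one, neg_zero] at this

/-- Dominated convergence, as `u x e^{-ux} ≤ 1`. -/
lemma tendsto_mul_deriv_laplaceExponent (hμ : μ (Iio 0) = 0) :
    Tendsto (fun u => u * deriv (laplaceExponent μ) u) (𝓝[>] 0) (𝓝 0) := by
  have h1 : Tendsto (fun u => ∫ x, u * x * Real.exp (-(u * x)) ∂μ) (𝓝[>] 0)
      (𝓝 (∫ x, 0 * x * Real.exp (-(0 * x)) ∂μ)) := by
    refine tendsto_integral_filter_of_dominated_convergence (fun _ => 1)
      (Eventually.of_forall fun u => by fun_prop) ?_ (by simp) (ae_of_all _ fun x => ?_)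
    · filter_upwards [self_mem_nhdsWithin] with u hu
      filter_upwards [ae_nonneg_of_null_Iio hμ] with x hx
      have hux : 0 ≤ u * x := mul_nonneg (le_of_lt hu) hx
      rw [Real.norm_of_nonneg (by positivity), Real.exp_neg, ← div_eq_mul_inv,
        div_le_one (Real.exp_pos _)]
      linarith [Real.add_one_le_exp (u * x)]
    · have : Continuous fun u => u * x * Real.exp (-(u * x)) := by fun_prop
      exact (this.tendsto 0).mono_left nhdsWithin_le_nhds
  have h2 := h1.div (tendsto_laplace_nhdsGT_zero hμ) one_ne_zero
  simp only [zero_mul, integral_zero, zero_div] at h2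
  refine h2.congr' ?_
  filter_upwards [self_mem_nhdsWithin] with u hu
  rw [Pi.div_apply, deriv_laplaceExponent hμ hu, ← mul_div_assoc, ← integral_const_mul]
  simp_rw [mul_assoc]

/-- `s ↦ -ψ(u e^{-s})` is a primitive of `s ↦ f(u e^{-s})` with `f(v) = v ψ'(v)`. -/
lemma hasDerivAt_neg_laplaceExponent_mul_exp (hμ : μ (Iio 0) = 0) {u : ℝ} (hu : 0 < u) (s : ℝ) :
    HasDerivAt (fun s => -laplaceExponent μ (u * Real.exp (-s)))
      (u * Real.exp (-s) * deriv (laplaceExponent μ) (u * Real.exp (-s))) s := by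
  have h1 : HasDerivAt (fun s => u * Real.exp (-s)) (u * (Real.exp (-s) * -1)) s :=
    ((hasDerivAt_neg s).exp).const_mul u
  have hpos : 0 < u * Real.exp (-s) := by positivity
  have h2 := ((hasDerivAt_laplaceExponent hμ hpos).differentiableAt.hasDerivAt.comp s h1).neg
  convert! h2 using 1
  ring

lemma lintegral_Ioc_mul_deriv_laplaceExponent (hμ : μ (Iio 0) = 0) {u T : ℝ} (hu : 0 ≤ u)
    (hT : 0 ≤ T) :
    ∫⁻ s in Ioc 0 T, .ofReal
      (u * Real.exp (-s) * deriv (laplaceExponent μ) (u * Real.exp (-s))) =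
    .ofReal (laplaceExponent μ u - laplaceExponent μ (u * Real.exp (-T))) := by
  rcases hu.eq_or_lt with rfl | hu
  · simp
  have hd := hasDerivAt_neg_laplaceExponent_mul_exp hμ hu
  have hnn (s : ℝ) : 0 ≤ u * Real.exp (-s) * deriv (laplaceExponent μ) (u * Real.exp (-s)) :=
    mul_nonneg (by positivity) (deriv_laplaceExponent_nonneg hμ (by positivity))
  have hi := intervalIntegral.integrableOn_deriv_of_nonneg (a := 0) (b := T)
    (fun s _ => (hd s).continuousAt.continuousWithinAt) (fun s _ => hd s) (fun s _ => hnn s)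
  rw [← ofReal_integral_eq_lintegral_ofReal hi (ae_of_all _ hnn),
    ← intervalIntegral.integral_of_le hT,
    intervalIntegral.integral_eq_sub_of_hasDerivAt (fun s _ => hd s)
      ((intervalIntegrable_iff_integrableOn_Ioc_of_le hT).2 hi)]
  simp only [neg_zero, Real.exp_zero, mul_one]
  congr 1
  ring

/-- The limit `T → ∞` of the preceding identity; `ψ` is continuous at `0`. -/
lemma lintegral_Ioi_mul_deriv_laplaceExponent (hμ : μ (Iio 0) = 0) {u : ℝ} (hu : 0 ≤ u) :
    ∫⁻ s in Ioi (0 : ℝ), .ofReal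
      (u * Real.exp (-s) * deriv (laplaceExponent μ) (u * Real.exp (-s))) =
    .ofReal (laplaceExponent μ u) := by
  rcases hu.eq_or_lt with rfl | hu
  · simp
  have hd := hasDerivAt_neg_laplaceExponent_mul_exp hμ hu
  have hnn (s : ℝ) : 0 ≤ u * Real.exp (-s) * deriv (laplaceExponent μ) (u * Real.exp (-s)) :=
    mul_nonneg (by positivity) (deriv_laplaceExponent_nonneg hμ (by positivity))
  have hlim : Tendsto (fun s => -laplaceExponent μ (u * Real.exp (-s))) atTop (𝓝 0) := by
    rw [← neg_zero]
    refine ((tendsto_laplaceExponent_nhdsGT_zero hμ).comp ?_).neg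
    refine tendsto_nhdsWithin_iff.2 ⟨?_, Eventually.of_forall fun s => ?_⟩
    · have := (Real.tendsto_exp_neg_atTop_nhds_zero).const_mul u
      simpa using this
    · exact mem_Ioi.2 (by positivity)
  have hi := integrableOn_Ioi_deriv_of_nonneg' (a := 0) (fun s _ => hd s) (fun s _ => hnn s) hlim
  rw [← ofReal_integral_eq_lintegral_ofReal hi (ae_of_all _ hnn),
    integral_Ioi_of_hasDerivAt_of_nonneg' (fun s _ => hd s) (fun s _ => hnn s) hlim]
  simp

end LaplaceExponent

/-- In a decomposition `X = cX' + Y` of a nonnegative random variable, `Y` is nonnegative: if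
`Y < -ε` had positive probability, the lower bound `X ≥ nε` would improve to `X ≥ (n + 1)ε`. -/
lemma null_Iio_of_selfdecomposition {μ ρ : Measure ℝ} [IsProbabilityMeasure μ]
    [IsProbabilityMeasure ρ] (hμ : μ (Iio 0) = 0) {c : ℝ} (hc : 0 < c) (hc1 : c < 1)
    (h : μ = (μ.prod ρ).map (fun p : ℝ × ℝ => c * p.1 + p.2)) : ρ (Iio 0) = 0 := by
  by_contra hρ
  obtain ⟨ε, hε, hρε⟩ : ∃ ε : ℝ, 0 < ε ∧ ρ (Iio (-ε)) ≠ 0 := by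
    by_contra! hcon
    refine hρ (measure_mono_null (t := ⋃ n : ℕ, Iio (-(1 / ((n : ℝ) + 1)))) (fun y hy => ?_)
      (measure_iUnion_null fun n => hcon _ (by positivity)))
    obtain ⟨n, hn⟩ := exists_nat_one_div_lt (show 0 < -y by simpa using hy)
    exact mem_iUnion.2 ⟨n, by simp only [mem_Iio]; linarith⟩
  have hmain (n : ℕ) : ∀ᵐ x ∂μ, n * ε ≤ x := by
    induction n with
    | zero => simpa using ae_nonneg_of_null_Iio hμ
    | succ n ih =>
      have hm : Measurable fun p : ℝ × ℝ => c * p.1 + p.2 := by fun_prop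
      have h1 : ∀ᵐ p ∂(μ.prod ρ), n * ε ≤ c * p.1 + p.2 := by
        rw [h] at ih
        exact ae_of_ae_map hm.aemeasurable ih
      have h2 : ∀ᵐ y ∂ρ, ∀ᵐ x ∂μ, n * ε ≤ c * x + y := by
        have h3 : ∀ᵐ p ∂(ρ.prod μ), n * ε ≤ c * p.2 + p.1 := by
          rw [← Measure.prod_swap] at h1
          exact ae_of_ae_map measurable_swap.aemeasurable h1
        exact Measure.ae_ae_of_ae_prod h3
      have h4 : ∃ᵐ y ∂ρ, y < -ε := by
        intro h5
        exact hρε (measure_mono_null (fun y hy => not_not.2 hy) (ae_iff.1 h5))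
      obtain ⟨y, hy, hy'⟩ := (h4.and_eventually h2).exists
      filter_upwards [hy', ae_nonneg_of_null_Iio hμ] with x hx hx0
      push_cast
      nlinarith
  have : ∀ᵐ x ∂μ, ∀ n : ℕ, n * ε ≤ x := ae_all_iff.2 hmain
  obtain ⟨x, hx⟩ := this.exists
  obtain ⟨n, hn⟩ := exists_nat_gt (x / ε)
  rw [div_lt_iff₀ hε] at hn
  linarith [hx n]

lemma laplace_selfdecomposition {μ ρ : Measure ℝ} [IsProbabilityMeasure μ]
    [IsProbabilityMeasure ρ] {c : ℝ}
    (h : μ = (μ.prod ρ).map (fun p : ℝ × ℝ => c * p.1 + p.2)) (u : ℝ) :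
    ∫ x, Real.exp (-(u * x)) ∂μ =
      (∫ x, Real.exp (-(c * u * x)) ∂μ) * ∫ y, Real.exp (-(u * y)) ∂ρ := by
  conv_lhs => rw [h]
  rw [integral_map (by fun_prop) (by fun_prop), ← integral_prod_mul]
  congr 1
  ext p
  rw [← Real.exp_add]
  congr 1
  ring

/-- If `μ` is selfdecomposable, then `uψ'(u)` is the limit of `(1 - E e^{-uY_c}) / (1 - c)` as
`c → 1`. -/
theorem IsSelfdecomposable.isBernstein_mul_deriv {μ : Measure ℝ} [IsProbabilityMeasure μ]
    (hμ : μ (Iio 0) = 0) (h : IsSelfdecomposable μ) :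
    IsBernstein fun u => u * deriv (laplaceExponent μ) u := by
  -- `c = 1 - ε n`, shifted by one because `c = 0` is not allowed
  let ε : ℕ → ℝ := fun n => 1 / ((n + 1 : ℕ) + 1)
  have hε0 (n : ℕ) : 0 < ε n := by simp only [ε]; positivity
  have hε1 (n : ℕ) : ε n < 1 := by
    simp only [ε]
    rw [div_lt_one (by positivity)]
    push_cast
    linarith [n.cast_nonneg (α := ℝ)]
  have hε : Tendsto ε atTop (𝓝 0) :=
    (tendsto_one_div_add_atTop_nhds_zero_nat (𝕜 := ℝ)).comp (tendsto_add_atTop_nat 1)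
  choose ρ hρ hρμ using fun n => h (1 - ε n) (by linarith [hε1 n]) (by linarith [hε0 n])
  have hρ0 (n : ℕ) : ρ n (Iio 0) = 0 :=
    null_Iio_of_selfdecomposition hμ (by linarith [hε1 n]) (by linarith [hε0 n]) (hρμ n)
  have hsm (n : ℕ) : IsFiniteMeasure (ENNReal.ofReal (ε n)⁻¹ • ρ n) :=
    Measure.smul_finite _ ENNReal.ofReal_ne_top
  refine isBernstein_of_tendsto (ν := fun n => ENNReal.ofReal (ε n)⁻¹ • ρ n)
    (fun n => by simp [hρ0 n]) (fun u hu => ?_) (tendsto_mul_deriv_laplaceExponent hμ)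
  rcases hu.eq_or_lt with rfl | hu
  · simp
  have hc1 (n : ℕ) : 0 < 1 - ε n := by linarith [hε1 n]
  let L : ℝ → ℝ := fun v => ∫ x, Real.exp (-(v * x)) ∂μ
  have hLpos {v : ℝ} (hv : 0 ≤ v) : 0 < L v := laplace_pos hμ hv
  have hval (n : ℕ) : ∫ t, (1 - Real.exp (-(u * t))) ∂(ENNReal.ofReal (ε n)⁻¹ • ρ n) =
      (ε n)⁻¹ * (L (u + -u * ε n) - L u) / L (u + -u * ε n) := by
    have h1 := laplace_selfdecomposition (hρμ n) u
    have h2 := hLpos (v := (1 - ε n) * u) (mul_nonneg (hc1 n).le hu.le)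
    have h3 : u + -u * ε n = (1 - ε n) * u := by ring
    have h4 : L u = L ((1 - ε n) * u) * ∫ y, Real.exp (-(u * y)) ∂(ρ n) := h1
    rw [integral_smul_measure, ENNReal.toReal_ofReal (inv_nonneg.2 (hε0 n).le),
      integral_sub (integrable_const _) (integrable_exp_neg_mul (hρ0 n) hu.le), h3, h4]
    simp only [integral_const, probReal_univ, smul_eq_mul, mul_one]
    rw [eq_div_iff h2.ne']
    ring
  simp_rw [hval]
  have hL : HasDerivAt L (-∫ x, x * Real.exp (-(u * x)) ∂μ) (u + -u * 0) := by
    simpa using hasDerivAt_laplace hμ hu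
  have hk : HasDerivAt (fun t => L (u + -u * t))
      ((-∫ x, x * Real.exp (-(u * x)) ∂μ) * (-u * 1)) 0 :=
    hL.comp (h := fun t => u + -u * t) 0 (((hasDerivAt_id (0 : ℝ)).const_mul (-u)).const_add u)
  have hs := hk.tendsto_slope_zero.comp (tendsto_nhdsWithin_iff.2
    ⟨hε, Eventually.of_forall fun n => (hε0 n).ne'⟩)
  have hk' : Tendsto (fun n => L (u + -u * ε n)) atTop (𝓝 (L u)) := by
    have := hk.continuousAt.tendsto.comp hε
    simpa [Function.comp_def] using this
  have := hs.div hk' (hLpos hu.le).ne'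
  rw [deriv_laplaceExponent hμ hu]
  convert! this using 2
  · simp [Function.comp_def]
  · ring

/-! ### From Bernstein functions to selfdecomposability and subordinators -/

lemma laplaceExponent_mono {μ : Measure ℝ} [IsProbabilityMeasure μ] (hμ : μ (Iio 0) = 0) {u v : ℝ}
    (hu : 0 ≤ u) (huv : u ≤ v) : laplaceExponent μ u ≤ laplaceExponent μ v := by
  rw [laplaceExponent, laplaceExponent, neg_le_neg_iff]
  refine Real.log_le_log (laplace_pos hμ (hu.trans huv)) (integral_mono_ae
    (integrable_exp_neg_mul hμ (hu.trans huv)) (integrable_exp_neg_mul hμ hu) ?_)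
  filter_upwards [ae_nonneg_of_null_Iio hμ] with x hx
  exact Real.exp_le_exp.2 (neg_le_neg (mul_le_mul_of_nonneg_right huv hx))

lemma IsBernstein.comp_mul_left {f : ℝ → ℝ} (hf : IsBernstein f) {c : ℝ} (hc : 0 < c) :
    IsBernstein fun u => f (c * u) := by
  obtain ⟨a, ν, ha, hν, hint, hf⟩ := hf
  have hm : Measurable fun t : ℝ => c * t := by fun_prop
  refine ⟨a * c, ν.map (fun t => c * t), by positivity, ?_, ?_, fun u hu => ?_⟩
  · rw [Measure.map_apply hm measurableSet_Iic]
    convert hν using 2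
    ext t
    exact ⟨fun h => by_contra fun h' => not_lt.2 h (mul_pos hc (not_le.1 h')),
      fun h => mul_nonpos_of_nonneg_of_nonpos hc.le h⟩
  · rw [lintegral_map (by fun_prop) hm]
    calc _ ≤ ∫⁻ t, .ofReal (1 + c) * .ofReal (min 1 t) ∂ν := by
          refine lintegral_mono_ae ?_
          filter_upwards [ae_pos_of_null_Iic hν] with t ht
          rw [← ENNReal.ofReal_mul (by positivity)]
          refine ENNReal.ofReal_le_ofReal ?_
          rcases le_total 1 t with h | h
          · rw [min_eq_left h]; linarith [min_le_left 1 (c * t)]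
          · rw [min_eq_right h]; linarith [min_le_right 1 (c * t)]
      _ < ∞ := by
          rw [lintegral_const_mul _ (by fun_prop)]
          exact ENNReal.mul_lt_top ENNReal.ofReal_lt_top hint
  · dsimp only
    rw [hf _ (by positivity), integral_map hm.aemeasurable (by fun_prop)]
    have (t : ℝ) : u * (c * t) = c * u * t := by ring
    simp_rw [this]
    ring

/-- If `uψ'(u)` is the Bernstein function of `(a, ν)`, then `ψ(u) - ψ(cu)` is the one whose Lévy
measure is the image of `ds ν(dz)`, `0 < s ≤ log (1/c)`, under `(s, z) ↦ e^{-s} z`. -/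
theorem isBernstein_sub_of_isBernstein_mul_deriv {μ : Measure ℝ} [IsProbabilityMeasure μ]
    (hμ : μ (Iio 0) = 0) (h : IsBernstein fun u => u * deriv (laplaceExponent μ) u) {c : ℝ}
    (hc : 0 < c) (hc1 : c < 1) :
    IsBernstein fun u => laplaceExponent μ u - laplaceExponent μ (c * u) := by
  obtain ⟨a, ν, ha, hν, hint, hf⟩ := h
  have hsf := sFinite_of_lintegral_min_one hν hint
  lift a to ℝ≥0 using ha
  obtain ⟨T, hT, hcT⟩ : ∃ T : ℝ, 0 ≤ T ∧ Real.exp (-T) = c :=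
    ⟨-Real.log c, by linarith [Real.log_neg hc hc1], by rw [neg_neg, Real.exp_log hc]⟩
  have hk : Measurable fun p : ℝ × ℝ => Real.exp (-p.1) * p.2 := by fun_prop
  set m : Measure (ℝ × ℝ) := (volume.restrict (Ioc 0 T)).prod ν with hm
  have hae : ∀ᵐ p ∂m, 0 < p.1 ∧ 0 < p.2 := by
    have h1 : ∀ᵐ s ∂(volume.restrict (Ioc 0 T)), 0 < s := by
      filter_upwards [ae_restrict_mem measurableSet_Ioc] with s hs using hs.1
    exact (Measure.quasiMeasurePreserving_fst.ae h1).and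
      (Measure.quasiMeasurePreserving_snd.ae (ae_pos_of_null_Iic hν))
  have hν0 : (m.map fun p => Real.exp (-p.1) * p.2) (Iic 0) = 0 := by
    rw [Measure.map_apply hk measurableSet_Iic]
    refine measure_mono_null (t := {p | ¬(0 < p.1 ∧ 0 < p.2)}) (fun p hp hp' => ?_) (ae_iff.1 hae)
    have : 0 < Real.exp (-p.1) * p.2 := mul_pos (Real.exp_pos _) hp'.2
    exact absurd this (not_lt.2 hp)
  have hint0 : ∫⁻ t, ENNReal.ofReal (min 1 t) ∂(m.map fun p => Real.exp (-p.1) * p.2) < ∞ := by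
    rw [lintegral_map (by fun_prop) hk]
    calc _ ≤ ∫⁻ p, ENNReal.ofReal (min 1 p.2) ∂m := by
          refine lintegral_mono_ae ?_
          filter_upwards [hae] with p hp
          refine ENNReal.ofReal_le_ofReal (min_le_min_left _ ?_)
          exact mul_le_of_le_one_left hp.2.le (Real.exp_le_one_iff.2 (by linarith [hp.1]))
      _ = ENNReal.ofReal T * ∫⁻ t, ENNReal.ofReal (min 1 t) ∂ν := by
          rw [hm, lintegral_prod _ (by fun_prop)]
          simp [mul_comm]
      _ < ∞ := ENNReal.mul_lt_top ENNReal.ofReal_lt_top hint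
  have hexp : ∫⁻ s in Ioc 0 T, ENNReal.ofReal (Real.exp (-s)) = .ofReal (1 - c) := by
    have hi : IntervalIntegrable (fun s => Real.exp (-s)) volume 0 T :=
      (by fun_prop : Continuous fun s => Real.exp (-s)).intervalIntegrable _ _
    rw [← ofReal_integral_eq_lintegral_ofReal
      ((intervalIntegrable_iff_integrableOn_Ioc_of_le hT).1 hi)
      (ae_of_all _ fun s => (Real.exp_pos _).le), ← intervalIntegral.integral_of_le hT,
      intervalIntegral.integral_comp_neg (fun s => Real.exp s), integral_exp, neg_zero,
      Real.exp_zero, hcT]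
  have hc1' : 0 ≤ 1 - c := by linarith
  refine ⟨a * (1 - c), _, by positivity, hν0, hint0, fun u hu => ?_⟩
  have hkey : ENNReal.ofReal (laplaceExponent μ u - laplaceExponent μ (c * u)) =
      levyExponent (a * (1 - c).toNNReal) (m.map fun p => Real.exp (-p.1) * p.2) (.ofReal u) := by
    calc _ = ∫⁻ s in Ioc 0 T, levyExponent a ν (.ofReal (u * Real.exp (-s))) := by
          rw [mul_comm c, ← hcT, ← lintegral_Ioc_mul_deriv_laplaceExponent hμ hu hT]
          refine lintegral_congr fun s => ?_
          have hs : 0 ≤ u * Real.exp (-s) := by positivity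
          rw [levyExponent_ofReal a hν hint hs, ← hf _ hs]
      _ = ∫⁻ s in Ioc 0 T, (a * .ofReal u * .ofReal (Real.exp (-s)) +
            ∫⁻ z, (1 - expNeg (.ofReal u * .ofReal (Real.exp (-s) * z))) ∂ν) := by
          refine lintegral_congr fun s => ?_
          rw [levyExponent, ENNReal.ofReal_mul hu, mul_assoc]
          simp_rw [mul_assoc, ENNReal.ofReal_mul (Real.exp_pos (-s)).le]
      _ = _ := by
          rw [lintegral_add_left (by fun_prop), lintegral_const_mul _ (by fun_prop), hexp,
            levyExponent, lintegral_map (by fun_prop) hk, hm, lintegral_prod _ (by fun_prop),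
            ENNReal.coe_mul, ← ENNReal.ofReal, mul_right_comm]
  rw [levyExponent_ofReal _ hν0 hint0 hu] at hkey
  have hnn : 0 ≤ ∫ t, (1 - Real.exp (-(u * t))) ∂(m.map fun p => Real.exp (-p.1) * p.2) := by
    refine integral_nonneg_of_ae ?_
    filter_upwards [ae_pos_of_null_Iic hν0] with t ht using one_sub_exp_neg_nonneg hu ht.le
  rw [ENNReal.ofReal_eq_ofReal_iff _ (by positivity)] at hkey
  · dsimp only
    rw [hkey, NNReal.coe_mul, Real.coe_toNNReal _ hc1']
  · exact sub_nonneg.2 (laplaceExponent_mono hμ (by positivity) (by nlinarith))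

/-- A factorization `L_μ(u) = L_μ(cu) L_κ(u)` of the Laplace transform of `μ` gives a decomposition
`X = cX' + Y` in law. -/
theorem exists_selfdecomposition_of_laplace {μ : Measure ℝ} [IsProbabilityMeasure μ]
    (hμ : μ (Iio 0) = 0) {c : ℝ} (hc : 0 ≤ c) {κ : Measure ℝ≥0∞} [IsProbabilityMeasure κ]
    (hκ : ∀ᵐ y ∂κ, y < ∞)
    (h : ∀ u : ℕ, ∫⁻ x, expNeg (u * .ofReal x) ∂μ =
      (∫⁻ x, expNeg (u * .ofReal (c * x)) ∂μ) * ∫⁻ y, expNeg (u * y) ∂κ) :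
    ∃ ρ : Measure ℝ, IsProbabilityMeasure ρ ∧
      μ = (μ.prod ρ).map (fun p : ℝ × ℝ => c * p.1 + p.2) := by
  have hρ : IsProbabilityMeasure (κ.map ENNReal.toReal) :=
    Measure.isProbabilityMeasure_map ENNReal.measurable_toReal.aemeasurable
  refine ⟨κ.map ENNReal.toReal, hρ, ?_⟩
  have hm : Measurable fun p : ℝ × ℝ => c * p.1 + p.2 := by fun_prop
  have hae : ∀ᵐ p ∂(μ.prod (κ.map ENNReal.toReal)), 0 ≤ p.1 ∧ 0 ≤ p.2 := by
    refine (Measure.quasiMeasurePreserving_fst.ae (ae_nonneg_of_null_Iio hμ)).and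
      (Measure.quasiMeasurePreserving_snd.ae ?_)
    rw [ae_map_iff ENNReal.measurable_toReal.aemeasurable measurableSet_Ici]
    exact ae_of_all _ fun y => ENNReal.toReal_nonneg
  have := Measure.isProbabilityMeasure_map (μ := μ.prod (κ.map ENNReal.toReal)) hm.aemeasurable
  have hpos : ∀ᵐ x ∂((μ.prod (κ.map ENNReal.toReal)).map fun p : ℝ × ℝ => c * p.1 + p.2),
      0 ≤ x := by
    rw [ae_map_iff hm.aemeasurable measurableSet_Ici]
    filter_upwards [hae] with p hp using add_nonneg (mul_nonneg hc hp.1) hp.2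
  have hback {σ : Measure ℝ} (hσ : ∀ᵐ x ∂σ, 0 ≤ x) :
      (σ.map ENNReal.ofReal).map ENNReal.toReal = σ := by
    rw [Measure.map_map ENNReal.measurable_toReal ENNReal.measurable_ofReal]
    conv_rhs => rw [← Measure.map_id (μ := σ)]
    refine Measure.map_congr ?_
    filter_upwards [hσ] with x hx using ENNReal.toReal_ofReal hx
  rw [← hback hpos, ← hback (ae_nonneg_of_null_Iio hμ)]
  conv_rhs => rw [hback (ae_nonneg_of_null_Iio hμ)]
  congr 1
  have := Measure.isProbabilityMeasure_map (μ := μ) ENNReal.measurable_ofReal.aemeasurable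
  have := Measure.isProbabilityMeasure_map
    (μ := (μ.prod (κ.map ENNReal.toReal)).map fun p : ℝ × ℝ => c * p.1 + p.2)
    ENNReal.measurable_ofReal.aemeasurable
  refine ext_of_lintegral_expNeg_eq_one_dim fun u => ?_
  rw [lintegral_map (by fun_prop) (by fun_prop), lintegral_map (by fun_prop) (by fun_prop),
    lintegral_map (by fun_prop) hm, h]
  have h1 : ∫⁻ y, expNeg (u * y) ∂κ = ∫⁻ y, expNeg (u * .ofReal y) ∂(κ.map ENNReal.toReal) := by
    rw [lintegral_map (by fun_prop) ENNReal.measurable_toReal]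
    refine lintegral_congr_ae ?_
    filter_upwards [hκ] with y hy
    rw [ENNReal.ofReal_toReal hy.ne]
  rw [h1, ← lintegral_prod_mul (by fun_prop) (by fun_prop)]
  refine lintegral_congr_ae ?_
  filter_upwards [hae] with p hp
  rw [← expNeg_add, ← mul_add, ENNReal.ofReal_add (mul_nonneg hc hp.1) hp.2]

lemma lintegral_expNeg_natCast_mul_ofReal {μ : Measure ℝ} [IsProbabilityMeasure μ]
    (hμ : μ (Iio 0) = 0) (u : ℕ) :
    ∫⁻ x, expNeg (u * .ofReal x) ∂μ = .ofReal (Real.exp (-laplaceExponent μ u)) := by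
  rw [← lintegral_expNeg_mul_ofReal hμ u.cast_nonneg, ENNReal.ofReal_natCast]

/-- If `ψ(u) - ψ(cu)` is a Bernstein function, then it is the Laplace exponent of a subordinator at
time `1`, whose law supplies the cofactor `Y_c`. -/
theorem isSelfdecomposable_of_isBernstein_sub {μ : Measure ℝ} [IsProbabilityMeasure μ]
    (hμ : μ (Iio 0) = 0) (h : ∀ c : ℝ, 0 < c → c < 1 →
      IsBernstein (fun u => laplaceExponent μ u - laplaceExponent μ (c * u))) :
    IsSelfdecomposable μ := by
  intro c hc hc1
  obtain ⟨a, ν, ha, hν, hint, hf⟩ := h c hc hc1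
  have hsf := sFinite_of_lintegral_min_one hν hint
  lift a to ℝ≥0 using ha
  obtain ⟨Ω, _, P, M, hP, hM⟩ := exists_isLevyRandomMeasure a ν
  have hmeas := measurable_measure_apply hM (measurableSet_Ioc (a := (0 : ℝ≥0)) (b := 1))
  have := Measure.isProbabilityMeasure_map (μ := P) hmeas.aemeasurable
  refine exists_selfdecomposition_of_laplace hμ hc.le (κ := P.map fun ω => M ω (Ioc 0 1)) ?_ ?_
  · rw [ae_map_iff hmeas.aemeasurable measurableSet_Iio]
    filter_upwards [hM.ae_lt_top hν hint] with ω hω using hω 1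
  · intro u
    have hu : (0 : ℝ) ≤ u := u.cast_nonneg
    have hle : laplaceExponent μ (c * u) ≤ laplaceExponent μ u :=
      laplaceExponent_mono hμ (by positivity) (by nlinarith)
    have h1 (x : ℝ) : (u : ℝ≥0∞) * .ofReal (c * x) = .ofReal (c * u) * .ofReal x := by
      rw [ENNReal.ofReal_mul hc.le, ENNReal.ofReal_mul hc.le, ENNReal.ofReal_natCast]
      ring
    simp_rw [h1]
    rw [lintegral_expNeg_natCast_mul_ofReal hμ, lintegral_expNeg_mul_ofReal hμ (by positivity),
      lintegral_map (by fun_prop) hmeas, hM.lintegral_expNeg_apply measurableSet_Ioc,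
      lebesgueNNReal_Ioc, ← ENNReal.ofReal_natCast, levyExponent_ofReal a hν hint hu, ← hf _ hu]
    simp only [ENNReal.coe_one, ENNReal.coe_zero, tsub_zero, mul_one]
    rw [expNeg_ofReal (sub_nonneg.2 hle), ← ENNReal.ofReal_mul (Real.exp_pos _).le, ← Real.exp_add]
    congr 2
    ring

lemma one_sub_expNeg_le (x : ℝ≥0∞) : 1 - expNeg x ≤ x := by
  induction x with
  | top => simp
  | coe x =>
    rw [← ENNReal.ofReal_coe_nnreal, expNeg_ofReal x.coe_nonneg, ← ENNReal.ofReal_one,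
      ← ENNReal.ofReal_sub _ (Real.exp_pos _).le]
    exact ENNReal.ofReal_le_ofReal (by linarith [Real.add_one_le_exp (-(x : ℝ))])

/-- For `s ≤ log x` one has `e^{-s} x ≥ 1`, so that the integrand is at least `1 - e^{-1}`. -/
lemma mul_posLog_le_lintegral {x : ℝ} (hx : 0 ≤ x) :
    (1 - expNeg 1) * ENNReal.ofReal (Real.posLog x) ≤
      ∫⁻ s in Ioi (0 : ℝ), (1 - expNeg (.ofReal (Real.exp (-s)) * .ofReal x)) := by
  rcases le_or_gt x 1 with hx1 | hx1
  · rw [Real.posLog_eq_zero_iff _ |>.2 (by rwa [abs_of_nonneg hx])]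
    simp
  have hx0 : 0 < x := by linarith
  rw [Real.posLog_eq_log (by rw [abs_of_nonneg hx]; exact hx1.le)]
  calc _ = ∫⁻ s in Ioc 0 (Real.log x), (1 - expNeg 1) := by
        rw [setLIntegral_const, Real.volume_Ioc, sub_zero]
    _ ≤ ∫⁻ s in Ioc 0 (Real.log x), (1 - expNeg (.ofReal (Real.exp (-s)) * .ofReal x)) := by
        refine setLIntegral_mono' measurableSet_Ioc fun s hs => ?_
        refine tsub_le_tsub_left (expNeg_antitone ?_) _
        rw [← ENNReal.ofReal_mul (Real.exp_pos _).le, ENNReal.one_le_ofReal, Real.exp_neg,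
          ← div_eq_inv_mul, one_le_div (Real.exp_pos _)]
        exact (Real.exp_le_exp.2 hs.2).trans_eq (Real.exp_log hx0)
    _ ≤ _ := lintegral_mono_set fun s hs => hs.1

/-- The logarithmic moment of `X_1` is controlled by `∫_0^∞ f(e^{-s}) ds`. -/
lemma IsLevyRandomMeasure.integrable_posLog {Ω : Type*} [MeasurableSpace Ω] {a : ℝ≥0}
    {ν : Measure ℝ} [SFinite ν] {P : Measure Ω} [IsProbabilityMeasure P] {M : Ω → Measure ℝ≥0}
    (hM : IsLevyRandomMeasure a ν P M)
    (hfin : ∫⁻ s in Ioi (0 : ℝ), levyExponent a ν (.ofReal (Real.exp (-s))) ≠ ∞) :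
    Integrable (fun ω => Real.posLog (distributionProcess M 1 ω)) P := by
  have hmeas := measurable_measure_apply hM (measurableSet_Ioc (a := (0 : ℝ≥0)) (b := 1))
  have hm1 : Measurable fun ω => Real.posLog (distributionProcess M 1 ω) := by
    have h2 : Measurable fun ω => distributionProcess M 1 ω := hmeas.ennreal_toReal
    have : Measurable Real.posLog := by
      simp only [Real.posLog_def]
      fun_prop
    exact this.comp h2
  refine ⟨hm1.aestronglyMeasurable, ?_⟩
  rw [hasFiniteIntegral_iff_ofReal (ae_of_all _ fun ω => Real.posLog_nonneg)]
  have hC : 1 - expNeg 1 ≠ 0 := by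
    have := expNeg_strictAnti (zero_lt_one (α := ℝ≥0∞))
    rw [expNeg_zero] at this
    exact (tsub_pos_of_lt this).ne'
  refine lt_top_iff_ne_top.2 fun htop => hfin ?_
  rw [← top_le_iff]
  calc ∞ = ∫⁻ ω, (1 - expNeg 1) * .ofReal (Real.posLog (distributionProcess M 1 ω)) ∂P := by
        rw [lintegral_const_mul _ (by fun_prop), htop, ENNReal.mul_top hC]
    _ ≤ ∫⁻ ω, (∫⁻ s in Ioi (0 : ℝ),
          (1 - expNeg (.ofReal (Real.exp (-s)) * M ω (Ioc 0 1)))) ∂P := by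
        refine lintegral_mono fun ω => (mul_posLog_le_lintegral ENNReal.toReal_nonneg).trans ?_
        refine lintegral_mono fun s => tsub_le_tsub_left (expNeg_antitone ?_) _
        exact mul_le_mul_right ENNReal.ofReal_toReal_le _
    _ = ∫⁻ s in Ioi (0 : ℝ), ∫⁻ ω, (1 - expNeg (.ofReal (Real.exp (-s)) * M ω (Ioc 0 1))) ∂P := by
        rw [lintegral_lintegral_swap]
        fun_prop
    _ = ∫⁻ s in Ioi (0 : ℝ), (1 - expNeg (levyExponent a ν (.ofReal (Real.exp (-s))))) := by
        refine lintegral_congr fun s => ?_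
        rw [lintegral_sub' (by fun_prop) _ (ae_of_all _ fun ω => expNeg_le_one _),
          hM.lintegral_expNeg_apply measurableSet_Ioc, lebesgueNNReal_Ioc]
        · simp
        · rw [hM.lintegral_expNeg_apply measurableSet_Ioc]
          exact expNeg_ne_top _
    _ ≤ _ := lintegral_mono fun s => one_sub_expNeg_le _

/-- If `f(u) = uψ'(u)` is a Bernstein function, then `ψ(u) = ∫_0^∞ f(ue^{-s}) ds` is the Laplace
exponent of `∫ e^{-t} dX_t` for the subordinator `X` with Laplace exponent `f`. -/
theorem exists_subordinator_of_isBernstein_mul_deriv {μ : Measure ℝ} [IsProbabilityMeasure μ]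
    (hμ : μ (Iio 0) = 0) (h : IsBernstein fun u => u * deriv (laplaceExponent μ) u) :
    ∃ (Ω : Type) (_ : MeasurableSpace Ω) (P : Measure Ω) (X : ℝ≥0 → Ω → ℝ),
      IsProbabilityMeasure P ∧ IsSubordinator X P ∧
      Integrable (fun ω => Real.posLog (X 1 ω)) P ∧
      HasLaw (expIntegral X) (μ.map ENNReal.ofReal) P := by
  obtain ⟨a, ν, ha, hν, hint, hf⟩ := h
  have hsf := sFinite_of_lintegral_min_one hν hint
  lift a to ℝ≥0 using ha
  obtain ⟨Ω, _, P, M, hP, hM⟩ := exists_isLevyRandomMeasure a ν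
  have hψ {u : ℝ} (hu : 0 ≤ u) :
      ∫⁻ s in Ioi (0 : ℝ), levyExponent a ν (.ofReal (u * Real.exp (-s))) =
        .ofReal (laplaceExponent μ u) := by
    rw [← lintegral_Ioi_mul_deriv_laplaceExponent hμ hu]
    refine lintegral_congr fun s => ?_
    have hs : 0 ≤ u * Real.exp (-s) := by positivity
    rw [levyExponent_ofReal a hν hint hs, ← hf _ hs]
  obtain ⟨hI, hI'⟩ := hM.lintegral_expNeg_expIntegral hν hint
  refine ⟨Ω, _, P, distributionProcess M, hP, hM.isSubordinator hν hint,
    hM.integrable_posLog ?_, hI, ?_⟩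
  · have := hψ zero_le_one
    simp only [one_mul] at this
    rw [this]
    exact ENNReal.ofReal_ne_top
  · have := Measure.isProbabilityMeasure_map hI
    have := Measure.isProbabilityMeasure_map (μ := μ) ENNReal.measurable_ofReal.aemeasurable
    refine ext_of_lintegral_expNeg_eq_one_dim fun u => ?_
    rw [lintegral_map' (by fun_prop) hI, lintegral_map (by fun_prop) ENNReal.measurable_ofReal,
      lintegral_expNeg_natCast_mul_ofReal hμ, ← ENNReal.ofReal_natCast, hI' _ u.cast_nonneg,
      hψ u.cast_nonneg, expNeg_ofReal (laplaceExponent_nonneg hμ u.cast_nonneg)]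

/-! ### Selfdecomposability of exponential integrals -/

/-- The value of `e^{-t}` at the right end point of the `k`-th interval of the grid of mesh `h`. -/
noncomputable def gridWeight (h : ℝ≥0) (k : ℕ) : ℝ≥0∞ :=
  .ofReal (Real.exp (-((k + 1 : ℕ) * h : ℝ≥0)))

lemma gridWeight_add (h : ℝ≥0) (n k : ℕ) :
    gridWeight h (n + k) = .ofReal (Real.exp (-(n * h : ℝ≥0))) * gridWeight h k := by
  rw [gridWeight, gridWeight, ← ENNReal.ofReal_mul (Real.exp_pos _).le, ← Real.exp_add]
  congr 2
  push_cast
  ring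

/-- The increment of `X` over the `k`-th interval of the grid of mesh `h`. -/
noncomputable def gridIncrement {Ω : Type*} (X : ℝ≥0 → Ω → ℝ) (h : ℝ≥0) (k : ℕ) (ω : Ω) : ℝ≥0∞ :=
  .ofReal (X ((k + 1 : ℕ) * h) ω - X (k * h) ω)

lemma monotone_grid (h : ℝ≥0) : Monotone fun k : ℕ => (k : ℝ≥0) * h := fun _ _ hij => by
  dsimp only; gcongr

lemma gridWeight_mul_le (m : Measure ℝ≥0) (h : ℝ≥0) (k : ℕ) :
    gridWeight h k * m (Ioc (k * h) ((k + 1 : ℕ) * h)) ≤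
      ∫⁻ t in Ioc (k * h) ((k + 1 : ℕ) * h), .ofReal (Real.exp (-(t : ℝ))) ∂m := by
  rw [← setLIntegral_const]
  refine setLIntegral_mono' measurableSet_Ioc fun t ht => ENNReal.ofReal_le_ofReal ?_
  exact Real.exp_le_exp.2 (neg_le_neg (NNReal.coe_le_coe.2 ht.2))

lemma le_exp_mul_gridWeight (m : Measure ℝ≥0) (h : ℝ≥0) (k : ℕ) :
    .ofReal (Real.exp (-h)) *
        ∫⁻ t in Ioc (k * h) ((k + 1 : ℕ) * h), .ofReal (Real.exp (-(t : ℝ))) ∂m ≤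
      gridWeight h k * m (Ioc (k * h) ((k + 1 : ℕ) * h)) := by
  rw [← setLIntegral_const, ← lintegral_const_mul _ (by fun_prop)]
  refine setLIntegral_mono' measurableSet_Ioc fun t ht => ?_
  rw [gridWeight, ← ENNReal.ofReal_mul (Real.exp_pos _).le, ← Real.exp_add]
  refine ENNReal.ofReal_le_ofReal (Real.exp_le_exp.2 ?_)
  have : ((k * h : ℝ≥0) : ℝ) ≤ t := NNReal.coe_le_coe.2 ht.1.le
  push_cast at this ⊢
  linarith

lemma sum_setLIntegral_grid (m : Measure ℝ≥0) (h : ℝ≥0) (g : ℝ≥0 → ℝ≥0∞) (n : ℕ) :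
    ∑ k ∈ Finset.range n, ∫⁻ t in Ioc ((k : ℝ≥0) * h) ((k + 1 : ℕ) * h), g t ∂m =
      ∫⁻ t in Ioc 0 (n * h), g t ∂m := by
  induction n with
  | zero => simp
  | succ n ih =>
    rw [Finset.sum_range_succ, ih, ← lintegral_union measurableSet_Ioc
      (Set.disjoint_left.2 fun x hx hy => not_lt.2 hx.2 hy.1),
      Ioc_union_Ioc_eq_Ioc zero_le (monotone_grid h n.le_succ)]

lemma tsum_setLIntegral_grid (m : Measure ℝ≥0) {h : ℝ≥0} (hh : 0 < h) (g : ℝ≥0 → ℝ≥0∞) :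
    ∑' k : ℕ, ∫⁻ t in Ioc ((k : ℝ≥0) * h) ((k + 1 : ℕ) * h), g t ∂m = ∫⁻ t in Ioi 0, g t ∂m := by
  have hU : (⋃ k : ℕ, Ioc ((k : ℝ≥0) * h) ((k + 1 : ℕ) * h)) = Ioi 0 := by
    have := iUnion_Ioc_map_succ_eq_Ioi (f := fun k : ℕ => (k : ℝ≥0) * h) (by simp) ?_
    · simpa using this
    · rintro ⟨b, hb⟩
      obtain ⟨n, hn⟩ := exists_nat_gt (b / h)
      rw [div_lt_iff₀ hh] at hn
      exact absurd (hb ⟨n, rfl⟩) (not_le.2 hn)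
  rw [← hU]
  exact (lintegral_iUnion (fun k => measurableSet_Ioc)
    (monotone_grid h).pairwise_disjoint_on_Ioc_succ g).symm

/-- Riemann sums of `∫ e^{-t} dX_t` for the mesh `T / (n + 1)` converge, because they agree with the
integral up to a factor between `e^{-T / (n + 1)}` and `1`. This also covers `I = ∞`. -/
lemma tendsto_of_exp_mul_le {T : ℝ≥0} {S : ℕ → ℝ≥0∞} {I : ℝ≥0∞}
    (h1 : ∀ n, S n ≤ I) (h2 : ∀ n : ℕ, .ofReal (Real.exp (-(T / (n + 1 : ℕ) : ℝ≥0))) * I ≤ S n) :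
    Tendsto S atTop (𝓝 I) := by
  refine tendsto_of_tendsto_of_tendsto_of_le_of_le ?_ tendsto_const_nhds h2 h1
  have h3 : Tendsto (fun n : ℕ => ((T / (n + 1 : ℕ) : ℝ≥0) : ℝ)) atTop (𝓝 0) := by
    have := (tendsto_one_div_add_atTop_nhds_zero_nat (𝕜 := ℝ)).const_mul (T : ℝ)
    simpa [div_eq_mul_inv] using this
  have h4 : Tendsto (fun n : ℕ => ENNReal.ofReal (Real.exp (-(T / (n + 1 : ℕ) : ℝ≥0)))) atTop
      (𝓝 1) := by
    have := ENNReal.tendsto_ofReal ((Real.continuous_exp.tendsto _).comp h3.neg)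
    simpa [Function.comp_def] using this
  simpa using ENNReal.Tendsto.mul_const h4 (Or.inl one_ne_zero)

lemma measurable_gridIncrement {Ω : Type*} [MeasurableSpace Ω] {P : Measure Ω} {X : ℝ≥0 → Ω → ℝ}
    (hX : IsLevyProcess X P) (h : ℝ≥0) (k : ℕ) : Measurable (gridIncrement X h k) :=
  ((hX.measurable _).sub (hX.measurable _)).ennreal_ofReal

/-- The Laplace transform of a Riemann sum of a Lévy process is a product. -/
lemma lintegral_expNeg_gridSum {Ω : Type*} [MeasurableSpace Ω] {P : Measure Ω}
    {X : ℝ≥0 → Ω → ℝ} (hX : IsLevyProcess X P) (h : ℝ≥0) (v : ℝ≥0∞) (n : ℕ) :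
    ∫⁻ ω, expNeg (v * ∑ k ∈ Finset.range n, gridWeight h k * gridIncrement X h k ω) ∂P =
      ∏ k ∈ Finset.range n, ∫⁻ ω, expNeg (v * gridWeight h k * .ofReal (X h ω - X 0 ω)) ∂P := by
  have hind := hX.indep_increments.nat (monotone_grid h)
  have h1 := hind.comp (fun k x => expNeg (v * (gridWeight h k * .ofReal x))) fun k => by fun_prop
  simp_rw [Finset.mul_sum, expNeg_sum]
  refine (lintegral_prod_eq_prod_lintegral_of_indepFun _ _ h1 fun k => ?_).trans
    (Finset.prod_congr rfl fun k _ => ?_)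
  · have := measurable_gridIncrement hX h k
    exact measurable_expNeg.comp ((this.const_mul _).const_mul _)
  · have h2 := (hX.stationary_increments (k * h) h).comp
      (u := fun x => expNeg (v * (gridWeight h k * .ofReal x))) (by fun_prop)
    have h3 : ((k + 1 : ℕ) : ℝ≥0) * h = k * h + h := by push_cast; ring
    have := h2.lintegral_eq
    simp only [Function.comp_def] at this ⊢
    rw [h3, this]
    simp_rw [mul_assoc]

/-- Splitting the grid of mesh `h` at time `T = nh` factorizes the Laplace transform of the Riemann
sum of `∫ e^{-t} dX_t`; by stationarity the part after `T` has the law of `e^{-T}` times the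
whole sum. -/
lemma lintegral_expNeg_gridSum_split {Ω : Type*} [MeasurableSpace Ω] {P : Measure Ω}
    {X : ℝ≥0 → Ω → ℝ} (hX : IsLevyProcess X P) (h : ℝ≥0) {v : ℝ≥0∞} (hv : v ≠ ∞) (n : ℕ) :
    ∫⁻ ω, expNeg (v * ∑' k, gridWeight h k * gridIncrement X h k ω) ∂P =
      (∫⁻ ω, expNeg (v * ∑ k ∈ Finset.range n, gridWeight h k * gridIncrement X h k ω) ∂P) *
      ∫⁻ ω, expNeg (v * .ofReal (Real.exp (-(n * h : ℝ≥0))) *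
        ∑' k, gridWeight h k * gridIncrement X h k ω) ∂P := by
  have hP : IsProbabilityMeasure P := (hX.indep_increments 0 (fun _ => 0)
    (fun _ _ _ => le_rfl)).isProbabilityMeasure
  have hlim {v : ℝ≥0∞} (hv : v ≠ ∞) : Tendsto (fun N => ∫⁻ ω, expNeg (v * ∑ k ∈ Finset.range N,
      gridWeight h k * gridIncrement X h k ω) ∂P) atTop
      (𝓝 (∫⁻ ω, expNeg (v * ∑' k, gridWeight h k * gridIncrement X h k ω) ∂P)) := by
    refine tendsto_lintegral_of_dominated_convergence (fun _ => 1) (fun N => ?_)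
      (fun N => ae_of_all _ fun ω => expNeg_le_one _) (by simp) (ae_of_all _ fun ω => ?_)
    · exact measurable_expNeg.comp ((Finset.measurable_fun_sum _ fun k _ =>
        (measurable_gridIncrement hX h k).const_mul _).const_mul _)
    · exact (continuous_expNeg.tendsto _).comp (ENNReal.Tendsto.const_mul
        (ENNReal.tendsto_nat_tsum _) (Or.inr hv))
  have hsplit (N : ℕ) := lintegral_expNeg_gridSum hX h v (n + N)
  simp_rw [Finset.prod_range_add, gridWeight_add, ← mul_assoc v] at hsplit
  simp_rw [← lintegral_expNeg_gridSum hX] at hsplit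
  refine tendsto_nhds_unique ((hlim hv).comp (tendsto_atTop_atTop.2 fun b => ⟨b, fun N hN =>
    hN.trans (Nat.le_add_left N n)⟩)) ?_
  simp_rw [Function.comp_def, hsplit]
  refine ENNReal.Tendsto.const_mul (hlim (ENNReal.mul_ne_top hv ENNReal.ofReal_ne_top))
    (Or.inr (ne_top_of_le_ne_top ENNReal.one_ne_top ?_))
  calc _ ≤ ∫⁻ ω, 1 ∂P := lintegral_mono fun ω => expNeg_le_one _
    _ = 1 := by simp

/-- The law of `I = ∫_{(0,∞)} e^{-t} dX_t` is selfdecomposable: for `c = e^{-T}`, the integral over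
`(0, T]` is independent of the integral over `(T, ∞)`, which has the law of `c I`. -/
theorem isSelfdecomposable_of_hasLaw_expIntegral {μ : Measure ℝ} [IsProbabilityMeasure μ]
    (hμ : μ (Iio 0) = 0) {Ω : Type*} [MeasurableSpace Ω] {P : Measure Ω} [IsProbabilityMeasure P]
    {X : ℝ≥0 → Ω → ℝ} (hX : IsSubordinator X P)
    (hlaw : HasLaw (expIntegral X) (μ.map ENNReal.ofReal) P) : IsSelfdecomposable μ := by
  intro c hc hc1
  obtain ⟨T, hT, hcT⟩ : ∃ T : ℝ≥0, 0 < T ∧ Real.exp (-T) = c := by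
    have := Real.log_neg hc hc1
    refine ⟨(-Real.log c).toNNReal, Real.toNNReal_pos.2 (by linarith), ?_⟩
    rw [Real.coe_toNNReal _ (by linarith), neg_neg, Real.exp_log hc]
  let h : ℕ → ℝ≥0 := fun n => T / (n + 1 : ℕ)
  have hh (n : ℕ) : 0 < h n := by positivity
  have hnh (n : ℕ) : ((n + 1 : ℕ) : ℝ≥0) * h n = T := by
    simp only [h]; field_simp
  let I := expIntegral X
  let Y : Ω → ℝ≥0∞ := fun ω =>
    ∫⁻ t in Ioc 0 T, .ofReal (Real.exp (-(t : ℝ))) ∂(pathMeasure fun s => X s ω)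
  let S : ℕ → Ω → ℝ≥0∞ := fun n ω => ∑' k, gridWeight (h n) k * gridIncrement X (h n) k ω
  let R : ℕ → Ω → ℝ≥0∞ := fun n ω =>
    ∑ k ∈ Finset.range (n + 1), gridWeight (h n) k * gridIncrement X (h n) k ω
  have hD : ∀ᵐ ω ∂P, ∀ (n k : ℕ),
      (pathMeasure fun s => X s ω) (Ioc (k * h n) ((k + 1 : ℕ) * h n)) =
        gridIncrement X (h n) k ω := by
    filter_upwards [hX.nondecreasing, hX.right_continuous] with ω h1 h2 n k
    rw [pathMeasure, dif_pos ⟨h1, h2⟩, StieltjesFunction.measure_Ioc]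
    rfl
  have hS : ∀ᵐ ω ∂P, Tendsto (fun n => S n ω) atTop (𝓝 (I ω)) := by
    filter_upwards [hD] with ω hω
    refine tendsto_of_exp_mul_le (T := T) (fun n => ?_) fun n => ?_
    · simp only [S, I, expIntegral, ← hω, ← tsum_setLIntegral_grid _ (hh n)]
      exact ENNReal.tsum_le_tsum fun k => gridWeight_mul_le _ _ k
    · simp only [S, I, expIntegral, ← hω, ← tsum_setLIntegral_grid _ (hh n)]
      rw [← ENNReal.tsum_mul_left]
      exact ENNReal.tsum_le_tsum fun k => le_exp_mul_gridWeight _ _ k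
  have hR : ∀ᵐ ω ∂P, Tendsto (fun n => R n ω) atTop (𝓝 (Y ω)) := by
    filter_upwards [hD] with ω hω
    refine tendsto_of_exp_mul_le (T := T) (fun n => ?_) fun n => ?_
    · simp only [R, Y, ← hω]
      rw [← hnh n, ← sum_setLIntegral_grid]
      exact Finset.sum_le_sum fun k _ => gridWeight_mul_le _ _ k
    · simp only [R, Y, ← hω]
      conv_lhs => rw [← hnh n, ← sum_setLIntegral_grid, Finset.mul_sum]
      refine Finset.sum_le_sum fun k _ => ?_
      convert! le_exp_mul_gridWeight _ (h n) k using 3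
      rw [hnh]
  have hSm (n : ℕ) : Measurable (S n) := Measurable.tsum fun k =>
    (measurable_gridIncrement hX.toIsLevyProcess _ k).const_mul _
  have hRm (n : ℕ) : Measurable (R n) := Finset.measurable_fun_sum _ fun k _ =>
    (measurable_gridIncrement hX.toIsLevyProcess _ k).const_mul _
  have hYm : AEMeasurable Y P := aemeasurable_of_tendsto_metrizable_ae _
    (fun n => (hRm n).aemeasurable) hR
  have hlim {Z : ℕ → Ω → ℝ≥0∞} {W : Ω → ℝ≥0∞} (hZ : ∀ n, Measurable (Z n))
      (hZW : ∀ᵐ ω ∂P, Tendsto (fun n => Z n ω) atTop (𝓝 (W ω))) {v : ℝ≥0∞} (hv : v ≠ ∞) :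
      Tendsto (fun n => ∫⁻ ω, expNeg (v * Z n ω) ∂P) atTop (𝓝 (∫⁻ ω, expNeg (v * W ω) ∂P)) := by
    refine tendsto_lintegral_of_dominated_convergence (fun _ => 1)
      (fun n => measurable_expNeg.comp ((hZ n).const_mul _))
      (fun n => ae_of_all _ fun ω => expNeg_le_one _) (by simp) ?_
    filter_upwards [hZW] with ω hω
    exact (continuous_expNeg.tendsto _).comp (ENNReal.Tendsto.const_mul hω (Or.inr hv))
  have hfac {v : ℝ≥0∞} (hv : v ≠ ∞) : ∫⁻ ω, expNeg (v * I ω) ∂P =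
      (∫⁻ ω, expNeg (v * Y ω) ∂P) * ∫⁻ ω, expNeg (v * .ofReal c * I ω) ∂P := by
    have hle (W : Ω → ℝ≥0∞) : ∫⁻ ω, expNeg (W ω) ∂P ≠ ∞ := by
      refine ne_top_of_le_ne_top ENNReal.one_ne_top ?_
      calc _ ≤ ∫⁻ ω, 1 ∂P := lintegral_mono fun ω => expNeg_le_one _
        _ = 1 := by simp
    refine tendsto_nhds_unique (hlim hSm hS hv) ?_
    have h1 (n : ℕ) : ∫⁻ ω, expNeg (v * S n ω) ∂P =
        (∫⁻ ω, expNeg (v * R n ω) ∂P) * ∫⁻ ω, expNeg (v * .ofReal c * S n ω) ∂P := by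
      have := lintegral_expNeg_gridSum_split hX.toIsLevyProcess (h n) hv (n + 1)
      rwa [hnh, hcT] at this
    simp_rw [h1]
    exact ENNReal.Tendsto.mul (hlim hRm hR hv) (Or.inr (hle _))
      (hlim hSm hS (ENNReal.mul_ne_top hv ENNReal.ofReal_ne_top)) (Or.inr (hle _))
  have htransfer (v : ℝ≥0∞) : ∫⁻ ω, expNeg (v * I ω) ∂P = ∫⁻ x, expNeg (v * .ofReal x) ∂μ := by
    rw [← lintegral_map' (f := fun y => expNeg (v * y)) (by fun_prop) hlaw.aemeasurable,
      hlaw.map_eq, lintegral_map (by fun_prop) ENNReal.measurable_ofReal]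
  have := Measure.isProbabilityMeasure_map hYm
  refine exists_selfdecomposition_of_laplace hμ hc.le (κ := P.map Y) ?_ fun u => ?_
  · rw [ae_map_iff hYm measurableSet_Iio]
    have hI : ∀ᵐ ω ∂P, I ω < ∞ := by
      refine ae_of_ae_map (p := fun y => y < ∞) hlaw.aemeasurable ?_
      rw [hlaw.map_eq, ae_map_iff ENNReal.measurable_ofReal.aemeasurable measurableSet_Iio]
      exact ae_of_all _ fun x => ENNReal.ofReal_lt_top
    filter_upwards [hI] with ω hω
    exact (lintegral_mono_set Ioc_subset_Ioi_self).trans_lt hω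
  · rw [← htransfer, hfac (ENNReal.natCast_ne_top u), htransfer, mul_comm,
      lintegral_map' (by fun_prop) hYm]
    simp_rw [ENNReal.ofReal_mul hc.le, mul_assoc]

/-! ### The equivalences -/

theorem proposition3p1 (μ : Measure ℝ) [IsProbabilityMeasure μ] (hμ : μ (Iio 0) = 0) :
    List.TFAE [
      IsSelfdecomposable μ,
      ∀ c : ℝ, 0 < c → c < 1 →
        IsBernstein (fun u => laplaceExponent μ u - laplaceExponent μ (c * u)),
      ∀ c : ℝ, 1 < c →
        IsBernstein (fun u => laplaceExponent μ (c * u) - laplaceExponent μ u),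
      IsBernstein (fun u => u * deriv (laplaceExponent μ) u),
      ∃ (Ω : Type) (_ : MeasurableSpace Ω) (P : Measure Ω) (X : ℝ≥0 → Ω → ℝ),
        IsProbabilityMeasure P ∧ IsSubordinator X P ∧
        Integrable (fun ω => Real.posLog (X 1 ω)) P ∧
        -- the integral, a priori `[0, ∞]`-valued, is a.s. finite and has law `μ`
        HasLaw (expIntegral X) (μ.map ENNReal.ofReal) P] := by
  tfae_have 1 → 4 := fun h => h.isBernstein_mul_deriv hμ
  tfae_have 4 → 2 := fun h c hc hc1 => isBernstein_sub_of_isBernstein_mul_deriv hμ h hc hc1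
  tfae_have 2 → 1 := fun h => isSelfdecomposable_of_isBernstein_sub hμ h
  tfae_have 2 → 3 := fun h c hc => by
    have hc0 : 0 < c := by linarith
    simpa [inv_mul_cancel_left₀ hc0.ne'] using
      (h c⁻¹ (inv_pos.2 hc0) (inv_lt_one_of_one_lt₀ hc)).comp_mul_left hc0
  tfae_have 3 → 2 := fun h c hc hc1 => by
    simpa [inv_mul_cancel_left₀ hc.ne'] using
      (h c⁻¹ ((one_lt_inv₀ hc).2 hc1)).comp_mul_left hc
  tfae_have 4 → 5 := fun h => exists_subordinator_of_isBernstein_mul_deriv hμ h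
  tfae_have 5 → 1 := fun ⟨_, _, _, _, _, hX, _, hlaw⟩ =>
    isSelfdecomposable_of_hasLaw_expIntegral hμ hX hlaw
  tfae_finish
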